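/- Let $E$ be a sequentially complete locally convex Hausdorff space over $\mathbb{C}$ and let $d\in\mathbb{N}_0$. For a locally convex Hausdorff space $G$ over $\mathbb{C}$ we use the following notation. - $\mathcal{C}^\infty_{2\pi}(\mathbb{R}^d,G)$ is the space of infinitely continuously partially differentiable functions $f\colon\mathbb{R}^d\to G$ that are $2\pi$-periodic in each variable, with the topology given by the seminorms $f\mapsto\sup\{p(\partial^\beta f(x)) : x\in K,\ |\beta|\le l\}$, where $K\subset\mathbb{R}^d$ is compact, $l\in\mathbb{N}_0$ and $p$ is a continuous seminorm on $G$. - $s(\mathbb{Z}^d,G)$ is the space of families $x=(x_k)_{k\in\mathbb{Z}^d}$ in $G$ with $|x|_{j,p}:=\sup_{k\in\mathbb{Z}^d}p(x_k)(1+|k|^2)^{j/2}<\infty$ for all $j\in\mathbb{N}_0$ and all continuous seminorms $p$ on $G$, with the topology given by the seminorms $|\cdot|_{j,p}$. - For a locally convex Hausdorff space $F$ over $\mathbb{C}$, $F\varepsilon G:=L_e(F'_\kappa,G)$ is the space of continuous linear maps $F'_\kappa\to G$ with the topology of uniform convergence on the equicontinuous subsets of $F'$, where $F'_\kappa$ is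 the dual $F'$ with the topology of uniform convergence on the absolutely convex compact subsets of $F$. For a continuous linear map $T\colon F_1\to F_2$, $T\varepsilon\,\mathrm{id}_G\colon F_1\varepsilon G\to F_2\varepsilon G$ is the map $u\mapsto u\circ T^t$ with $T^t(f')=f'\circ T$. - For $\mathcal F(\Omega)=\mathcal{C}^\infty_{2\pi}(\mathbb{R}^d):=\mathcal{C}^\infty_{2\pi}(\mathbb{R}^d,\mathbb{C})$ (with $\Omega=\mathbb{R}^d$) or $\mathcal F(\Omega)=s(\mathbb{Z}^d):=s(\mathbb{Z}^d,\mathbb{C})$ (with $\Omega=\mathbb{Z}^d$), and $\delta_x$ the evaluation at $x\in\Omega$, $S_{\mathcal F(\Omega)}$ is the map $u\mapsto[x\mapsto u(\delta_x)]$ on $\mathcal F(\Omega)\varepsilon E$. Then for all $f\in\mathcal{C}^\infty_{2\pi}(\mathbb{R}^d,E)$ and $n\in\mathbb{Z}^d$ the function $x\mapsto f(x)e^{-i\langle n,x\rangle}$ is Pettis-integrable on $[-\pi,\pi]^d$, and with $$\widehat f(n):=(2\pi)^{-d}\int_{[-\pi,\pi]^d}f(x)e^{-i\langle n,x\rangle}\,\mathrm{d}x$$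 (Pettis integral) the map $$\mathfrak F^E\colon\mathcal{C}^\infty_{2\pi}(\mathbb{R}^d,E)\to s(\mathbb{Z}^d,E),\quad \mathfrak F^E(f):=(\widehat f(n))_{n\in\mathbb{Z}^d},$$ is a well-defined linear topological isomorphism. Moreover $\mathfrak F^{\mathbb{C}}\colon\mathcal{C}^\infty_{2\pi}(\mathbb{R}^d)\to s(\mathbb{Z}^d)$, $S_{\mathcal{C}^\infty_{2\pi}(\mathbb{R}^d)}\colon\mathcal{C}^\infty_{2\pi}(\mathbb{R}^d)\varepsilon E\to\mathcal{C}^\infty_{2\pi}(\mathbb{R}^d,E)$ and $S_{s(\mathbb{Z}^d)}\colon s(\mathbb{Z}^d)\varepsilon E\to s(\mathbb{Z}^d,E)$ are well-defined linear topological isomorphisms, and $$\mathfrak F^E=S_{s(\mathbb{Z}^d)}\circ(\mathfrak F^{\mathbb{C}}\varepsilon\,\mathrm{id}_E)\circ S^{-1}_{\mathcal{C}^\infty_{2\pi}(\mathbb{R}^d)}.$$ -/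

import Mathlib

open MeasureTheory Filter Topology

set_option linter.unusedSectionVars false

noncomputable section

namespace PeriodicFourier

/-! ### Pettis integral and sequential completeness -/

section Basic

variable {E : Type*} [AddCommGroup E] [Module ℂ E] [TopologicalSpace E]

/-- `e` is a Pettis integral of `f` over the set `s`: for every continuous linear functional `e'`
the function `e' ∘ f` is integrable on `s`, and `e' e = ∫ x in s, e' (f x) ∂μ`. -/
def HasPettisIntegral {X : Type*} [MeasurableSpace X] (μ : Measure X) (s : Set X)
    (f : X → E) (e : E) : Prop :=
  ∀ e' : E →L[ℂ] ℂ, IntegrableOn (fun x => e' (f x)) s μ ∧ e' e = ∫ x in s, e' (f x) ∂μ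

def PettisIntegrable {X : Type*} [MeasurableSpace X] (μ : Measure X) (s : Set X)
    (f : X → E) : Prop :=
  ∃ e : E, HasPettisIntegral μ s f e

open Classical in
/-- The Pettis integral (and `0` if `f` is not Pettis-integrable on `s`). In a locally convex
Hausdorff space the vector chosen here is unique. -/
def pettisIntegral {X : Type*} [MeasurableSpace X] (μ : Measure X) (s : Set X)
    (f : X → E) : E :=
  if h : PettisIntegrable μ s f then h.choose else 0

end Basic

/-- Every Cauchy sequence converges. -/
def IsSequentiallyComplete (E : Type*) [UniformSpace E] : Prop :=
  ∀ u : ℕ → E, CauchySeq u → ∃ a : E, Tendsto u atTop (𝓝 a)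

/-! ### The epsilon product -/

section EpsilonProduct

/-- The dual of `F` with the topology of uniform convergence on the absolutely convex compact
subsets of `F`. -/
abbrev DualKappa (F : Type*) [AddCommGroup F] [Module ℂ F] [TopologicalSpace F] :=
  UniformConvergenceCLM (RingHom.id ℂ) (E := F) ℂ
    {K : Set F | IsCompact K ∧ Balanced ℂ K ∧ Convex ℝ K}

/-- The equicontinuous subsets of the dual of `F`. -/
def equicontinuousSets (F : Type*) [AddCommGroup F] [Module ℂ F] [TopologicalSpace F] :
    Set (Set (DualKappa F)) :=
  {H | Equicontinuous (fun f' : H => ((f' : DualKappa F) : F → ℂ))}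

/-- Schwartz' epsilon product: the continuous linear maps from `DualKappa F` to `E`, with the
topology of uniform convergence on the equicontinuous subsets of the dual of `F`. -/
abbrev EpsProd (F E : Type*) [AddCommGroup F] [Module ℂ F] [TopologicalSpace F]
    [AddCommGroup E] [Module ℂ E] [TopologicalSpace E] :=
  UniformConvergenceCLM (RingHom.id ℂ) (E := DualKappa F) E (equicontinuousSets F)

variable {F₁ F₂ E₁ E₂ : Type*}
  [AddCommGroup F₁] [Module ℂ F₁] [TopologicalSpace F₁]
  [AddCommGroup F₂] [Module ℂ F₂] [TopologicalSpace F₂]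
  [AddCommGroup E₁] [Module ℂ E₁] [TopologicalSpace E₁]
  [IsTopologicalAddGroup E₁] [ContinuousConstSMul ℂ E₁]
  [AddCommGroup E₂] [Module ℂ E₂] [TopologicalSpace E₂]
  [IsTopologicalAddGroup E₂] [ContinuousConstSMul ℂ E₂]

/-- The dual map `f' ↦ f' ∘ T`, between the duals with the `κ`-topologies. -/
def dualMap (T : F₁ →L[ℂ] F₂) : DualKappa F₂ →L[ℂ] DualKappa F₁ :=
  ContinuousLinearMap.precompUniformConvergenceCLM ℂ
    {K : Set F₁ | IsCompact K ∧ Balanced ℂ K ∧ Convex ℝ K}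
    {K : Set F₂ | IsCompact K ∧ Balanced ℂ K ∧ Convex ℝ K} T (by
      rintro K ⟨hK, hb, hc⟩
      refine ⟨hK.image T.continuous, ?_, ?_⟩
      · intro a ha
        rintro _ ⟨_, ⟨x, hx, rfl⟩, rfl⟩
        exact ⟨a • x, hb a ha ⟨x, hx, rfl⟩, T.map_smul a x⟩
      · exact hc.is_linear_image
          ⟨fun x y => T.map_add x y, fun c x => T.map_smul (c : ℂ) x⟩)

theorem dualMap_apply (T : F₁ →L[ℂ] F₂) (f' : DualKappa F₂) (x : F₁) :
    dualMap T f' x = f' (T x) := rfl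

/-- The epsilon product of operators, `u ↦ T₂ ∘ u ∘ T₁ᵗ`. -/
def epsMap (T₁ : F₁ →L[ℂ] F₂) (T₂ : E₁ →L[ℂ] E₂) : EpsProd F₁ E₁ →L[ℂ] EpsProd F₂ E₂ :=
  (ContinuousLinearMap.postcompUniformConvergenceCLM (equicontinuousSets F₂) T₂).comp
    (ContinuousLinearMap.precompUniformConvergenceCLM E₁
      (equicontinuousSets F₂) (equicontinuousSets F₁) (dualMap T₁) (by
        intro H hH x₀ U hU
        have h1 := (hH (T₁ x₀)) U hU
        filter_upwards [T₁.continuous.continuousAt.eventually h1] with x hx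
        rintro ⟨_, f', hf', rfl⟩
        exact hx ⟨f', hf'⟩))

theorem epsMap_apply (T₁ : F₁ →L[ℂ] F₂) (T₂ : E₁ →L[ℂ] E₂) (u : EpsProd F₁ E₁)
    (f' : DualKappa F₂) : epsMap T₁ T₂ u f' = T₂ (u (dualMap T₁ f')) := rfl

end EpsilonProduct

/-! ### Smooth functions

`Fin d → ℝ` serves as `ℝ^d`; only its topology, vector space structure and Lebesgue measure are
used, never a norm. -/

section Smooth

variable {d : ℕ} {E : Type*} [AddCommGroup E] [Module ℂ E] [TopologicalSpace E]

/-- `e` is the limit of `(f (x + h e_i) - f x) / h` as `h → 0`, `h` real and nonzero. -/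
def HasPartialDerivAt (f : (Fin d → ℝ) → E) (i : Fin d) (e : E) (x : Fin d → ℝ) : Prop :=
  Tendsto (fun h : ℝ => (h : ℂ)⁻¹ • (f (x + Pi.single i h) - f x)) (𝓝[≠] 0) (𝓝 e)

open Classical in
/-- The `i`-th partial derivative (with value `0` where it does not exist). -/
def partialDeriv (i : Fin d) (f : (Fin d → ℝ) → E) (x : Fin d → ℝ) : E :=
  if h : ∃ e, HasPartialDerivAt f i e x then h.choose else 0

/-- `k`-times continuously partially differentiable functions. -/
def IsCk : ℕ → ((Fin d → ℝ) → E) → Prop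
  | 0, f => Continuous f
  | k + 1, f => (∀ i, (∀ x, ∃ e, HasPartialDerivAt f i e x) ∧ Continuous (partialDeriv i f)) ∧
      ∀ i, IsCk k (partialDeriv i f)

def IsSmooth (f : (Fin d → ℝ) → E) : Prop := ∀ k, IsCk k f

/-- The derivative `∂₁^{β₁} ⋯ ∂_d^{β_d} f`. -/
def multiDeriv (β : Fin d → ℕ) (f : (Fin d → ℝ) → E) : (Fin d → ℝ) → E :=
  (List.finRange d).foldr (fun i g => (partialDeriv i)^[β i] g) f

theorem HasPartialDerivAt.partialDeriv_eq [T2Space E] {f : (Fin d → ℝ) → E} {i : Fin d} {e : E}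
    {x : Fin d → ℝ} (h : HasPartialDerivAt f i e x) : partialDeriv i f x = e := by
  have hex : ∃ e, HasPartialDerivAt f i e x := ⟨e, h⟩
  rw [partialDeriv, dif_pos hex]
  exact tendsto_nhds_unique hex.choose_spec h

theorem IsSmooth.continuous {f : (Fin d → ℝ) → E} (hf : IsSmooth f) : Continuous f := hf 0

theorem IsSmooth.hasPartialDerivAt {f : (Fin d → ℝ) → E} (hf : IsSmooth f) (i : Fin d)
    (x : Fin d → ℝ) : HasPartialDerivAt f i (partialDeriv i f x) x := by
  have hex := ((hf 1).1 i).1 x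
  rw [partialDeriv, dif_pos hex]
  exact hex.choose_spec

theorem IsSmooth.partialDeriv {f : (Fin d → ℝ) → E} (hf : IsSmooth f) (i : Fin d) :
    IsSmooth (partialDeriv i f) := fun k => (hf (k + 1)).2 i

theorem IsSmooth.iterate (i : Fin d) (n : ℕ) {f : (Fin d → ℝ) → E} (hf : IsSmooth f) :
    IsSmooth ((PeriodicFourier.partialDeriv i)^[n] f) := by
  induction n generalizing f with
  | zero => exact hf
  | succ n ih => exact ih (hf.partialDeriv i)

theorem IsSmooth.foldr {f : (Fin d → ℝ) → E} (hf : IsSmooth f) (β : Fin d → ℕ)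
    (l : List (Fin d)) :
    IsSmooth (l.foldr (fun i g => (PeriodicFourier.partialDeriv i)^[β i] g) f) := by
  induction l with
  | nil => exact hf
  | cons i l ih => exact ih.iterate i (β i)

theorem IsSmooth.multiDeriv {f : (Fin d → ℝ) → E} (hf : IsSmooth f) (β : Fin d → ℕ) :
    IsSmooth (multiDeriv β f) := hf.foldr β _

variable [IsTopologicalAddGroup E] [ContinuousConstSMul ℂ E] [T2Space E]

theorem HasPartialDerivAt.add {f g : (Fin d → ℝ) → E} {i : Fin d} {a b : E} {x : Fin d → ℝ}
    (hf : HasPartialDerivAt f i a x) (hg : HasPartialDerivAt g i b x) :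
    HasPartialDerivAt (f + g) i (a + b) x := by
  refine (Tendsto.add hf hg).congr fun h => ?_
  rw [← smul_add]
  congr 1
  simp only [Pi.add_apply]
  abel

theorem HasPartialDerivAt.smul {f : (Fin d → ℝ) → E} {i : Fin d} {a : E} {x : Fin d → ℝ}
    (c : ℂ) (hf : HasPartialDerivAt f i a x) : HasPartialDerivAt (c • f) i (c • a) x := by
  refine (Tendsto.const_smul hf c).congr fun h => ?_
  rw [smul_comm, smul_sub]
  rfl

theorem IsSmooth.partialDeriv_add {f g : (Fin d → ℝ) → E} (hf : IsSmooth f) (hg : IsSmooth g)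
    (i : Fin d) : PeriodicFourier.partialDeriv i (f + g) =
      PeriodicFourier.partialDeriv i f + PeriodicFourier.partialDeriv i g :=
  funext fun x => ((hf.hasPartialDerivAt i x).add (hg.hasPartialDerivAt i x)).partialDeriv_eq

theorem IsSmooth.partialDeriv_smul {f : (Fin d → ℝ) → E} (c : ℂ) (hf : IsSmooth f)
    (i : Fin d) : PeriodicFourier.partialDeriv i (c • f) =
      c • PeriodicFourier.partialDeriv i f :=
  funext fun x => ((hf.hasPartialDerivAt i x).smul c).partialDeriv_eq

theorem IsSmooth.add {f g : (Fin d → ℝ) → E} (hf : IsSmooth f) (hg : IsSmooth g) :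
    IsSmooth (f + g) := by
  intro k
  induction k generalizing f g with
  | zero => exact Continuous.add hf.continuous hg.continuous
  | succ k ih =>
    refine ⟨fun i => ⟨fun x => ⟨_, (hf.hasPartialDerivAt i x).add (hg.hasPartialDerivAt i x)⟩, ?_⟩,
      fun i => ?_⟩
    · rw [hf.partialDeriv_add hg]
      exact Continuous.add (hf.partialDeriv i).continuous (hg.partialDeriv i).continuous
    · rw [hf.partialDeriv_add hg]
      exact ih (hf.partialDeriv i) (hg.partialDeriv i)

theorem IsSmooth.smul {f : (Fin d → ℝ) → E} (c : ℂ) (hf : IsSmooth f) : IsSmooth (c • f) := by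
  intro k
  induction k generalizing f with
  | zero => exact Continuous.const_smul hf.continuous c
  | succ k ih =>
    refine ⟨fun i => ⟨fun x => ⟨_, (hf.hasPartialDerivAt i x).smul c⟩, ?_⟩, fun i => ?_⟩
    · rw [hf.partialDeriv_smul c]
      exact Continuous.const_smul (hf.partialDeriv i).continuous c
    · rw [hf.partialDeriv_smul c]
      exact ih (hf.partialDeriv i)

theorem isSmooth_zero : IsSmooth (0 : (Fin d → ℝ) → E) := by
  have h0 : ∀ (i : Fin d) (x : Fin d → ℝ), HasPartialDerivAt (0 : (Fin d → ℝ) → E) i 0 x := by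
    intro i x
    simp [HasPartialDerivAt]
  have h1 : ∀ i : Fin d, partialDeriv i (0 : (Fin d → ℝ) → E) = 0 :=
    fun i => funext fun x => (h0 i x).partialDeriv_eq
  intro k
  induction k with
  | zero => exact continuous_const
  | succ k ih =>
    exact ⟨fun i => ⟨fun x => ⟨0, h0 i x⟩, by rw [h1 i]; exact continuous_const⟩,
      fun i => by rw [h1 i]; exact ih⟩

theorem IsSmooth.iterate_add (i : Fin d) (n : ℕ) {f g : (Fin d → ℝ) → E} (hf : IsSmooth f)
    (hg : IsSmooth g) : (PeriodicFourier.partialDeriv i)^[n] (f + g) =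
      (PeriodicFourier.partialDeriv i)^[n] f + (PeriodicFourier.partialDeriv i)^[n] g := by
  induction n generalizing f g with
  | zero => rfl
  | succ n ih =>
    rw [Function.iterate_succ_apply, Function.iterate_succ_apply, Function.iterate_succ_apply,
      hf.partialDeriv_add hg]
    exact ih (hf.partialDeriv i) (hg.partialDeriv i)

theorem IsSmooth.iterate_smul (i : Fin d) (n : ℕ) (c : ℂ) {f : (Fin d → ℝ) → E}
    (hf : IsSmooth f) : (PeriodicFourier.partialDeriv i)^[n] (c • f) =
      c • (PeriodicFourier.partialDeriv i)^[n] f := by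
  induction n generalizing f with
  | zero => rfl
  | succ n ih =>
    rw [Function.iterate_succ_apply, Function.iterate_succ_apply, hf.partialDeriv_smul c]
    exact ih (hf.partialDeriv i)

theorem IsSmooth.multiDeriv_add {f g : (Fin d → ℝ) → E} (hf : IsSmooth f) (hg : IsSmooth g)
    (β : Fin d → ℕ) : PeriodicFourier.multiDeriv β (f + g) =
      PeriodicFourier.multiDeriv β f + PeriodicFourier.multiDeriv β g := by
  unfold PeriodicFourier.multiDeriv
  induction (List.finRange d) with
  | nil => rfl
  | cons i l ih =>
    simp only [List.foldr_cons]
    rw [ih, (hf.foldr β l).iterate_add i (β i) (hg.foldr β l)]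

theorem IsSmooth.multiDeriv_smul (c : ℂ) {f : (Fin d → ℝ) → E} (hf : IsSmooth f)
    (β : Fin d → ℕ) : PeriodicFourier.multiDeriv β (c • f) =
      c • PeriodicFourier.multiDeriv β f := by
  unfold PeriodicFourier.multiDeriv
  induction (List.finRange d) with
  | nil => rfl
  | cons i l ih =>
    simp only [List.foldr_cons]
    rw [ih, (hf.foldr β l).iterate_smul i (β i) c]

variable (d E) in
def smoothSubmodule : Submodule ℂ ((Fin d → ℝ) → E) where
  carrier := {f | IsSmooth f}
  add_mem' := fun hf hg => hf.add hg
  zero_mem' := isSmooth_zero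
  smul_mem' := fun c _ hf => hf.smul c

variable (d E) in
/-- The space of smooth functions from `ℝ^d` to `E`. It is a type of its own, so that it does not
inherit the topology of pointwise convergence. -/
def Smooth : Type _ := ↥(smoothSubmodule d E)

instance : AddCommGroup (Smooth d E) := inferInstanceAs (AddCommGroup ↥(smoothSubmodule d E))

instance : Module ℂ (Smooth d E) := inferInstanceAs (Module ℂ ↥(smoothSubmodule d E))

instance : FunLike (Smooth d E) (Fin d → ℝ) E where
  coe f := f.1
  coe_injective _ _ h := Subtype.ext h

theorem Smooth.isSmooth (f : Smooth d E) : IsSmooth f := f.2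

theorem Smooth.coe_add (f g : Smooth d E) : ⇑(f + g) = ⇑f + ⇑g := rfl

theorem Smooth.coe_smul (c : ℂ) (f : Smooth d E) : ⇑(c • f) = c • ⇑f := rfl

variable (d) in
/-- The multi-indices of length at most `l`. -/
abbrev MultiIndex (l : ℕ) := {β : Fin d → ℕ // ∑ i, β i ≤ l}

instance (l : ℕ) : Finite (MultiIndex d l) := by
  refine Set.Finite.to_subtype ((Set.finite_Iic (fun _ : Fin d => l)).subset ?_)
  intro β hβ i
  exact (Finset.single_le_sum (f := β) (fun _ _ => Nat.zero_le _) (Finset.mem_univ i)).trans hβ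

theorem Smooth.bddAbove (K : TopologicalSpace.Compacts (Fin d → ℝ)) (l : ℕ)
    (p : {p : Seminorm ℂ E // Continuous p}) (f : Smooth d E) :
    BddAbove (Set.range fun z : K × MultiIndex d l => p.1 (multiDeriv z.2.1 f z.1.1)) := by
  have h : ∀ β : MultiIndex d l, BddAbove ((fun x => p.1 (multiDeriv β.1 f x)) '' (K : Set _)) :=
    fun β => K.isCompact.bddAbove_image
      (p.2.comp (f.isSmooth.multiDeriv β.1).continuous).continuousOn
  choose C hC using h
  obtain ⟨B, hB⟩ := (Set.finite_range C).bddAbove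
  refine ⟨B, ?_⟩
  rintro _ ⟨⟨x, β⟩, rfl⟩
  exact (hC β ⟨x.1, x.2, rfl⟩).trans (hB ⟨β, rfl⟩)

/-- The seminorm `f ↦ sup {p (∂^β f x) | x ∈ K, |β| ≤ l}`. -/
def Smooth.seminorm (K : TopologicalSpace.Compacts (Fin d → ℝ)) (l : ℕ)
    (p : {p : Seminorm ℂ E // Continuous p}) : Seminorm ℂ (Smooth d E) :=
  Seminorm.ofSMulLE
    (fun f => ⨆ z : K × MultiIndex d l, p.1 (multiDeriv z.2.1 f z.1.1))
    (by
      refine le_antisymm (Real.iSup_le (fun z => ?_) le_rfl)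
        (Real.iSup_nonneg fun z => apply_nonneg _ _)
      have h0 := (0 : Smooth d E).isSmooth.multiDeriv_smul 0 z.2.1
      rw [← Smooth.coe_smul, smul_zero, zero_smul] at h0
      rw [h0]
      simp)
    (by
      intro f g
      refine Real.iSup_le (fun z => ?_) (add_nonneg (Real.iSup_nonneg fun z => apply_nonneg _ _)
        (Real.iSup_nonneg fun z => apply_nonneg _ _))
      rw [Smooth.coe_add, f.isSmooth.multiDeriv_add g.isSmooth]
      exact (map_add_le_add p.1 _ _).trans
        (add_le_add (le_ciSup (f.bddAbove K l p) z) (le_ciSup (g.bddAbove K l p) z)))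
    (by
      intro c f
      refine Real.iSup_le (fun z => ?_) (mul_nonneg (norm_nonneg _)
        (Real.iSup_nonneg fun z => apply_nonneg _ _))
      rw [Smooth.coe_smul, f.isSmooth.multiDeriv_smul c, Pi.smul_apply, map_smul_eq_mul]
      exact mul_le_mul_of_nonneg_left (le_ciSup (f.bddAbove K l p) z) (norm_nonneg _))

variable (d E) in
def Smooth.seminormFamily : SeminormFamily ℂ (Smooth d E)
    (TopologicalSpace.Compacts (Fin d → ℝ) × ℕ × {p : Seminorm ℂ E // Continuous p}) :=
  fun q => Smooth.seminorm q.1 q.2.1 q.2.2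

instance : TopologicalSpace (Smooth d E) :=
  (Smooth.seminormFamily d E).moduleFilterBasis.topology

theorem Smooth.withSeminorms : WithSeminorms (Smooth.seminormFamily d E) := ⟨rfl⟩

variable (d E) in
/-- The subspace of the smooth functions that are `2π`-periodic in each variable. -/
def smoothPeriodicSubmodule : Submodule ℂ (Smooth d E) where
  carrier := {f | ∀ (i : Fin d) (x : Fin d → ℝ), f (x + Pi.single i (2 * Real.pi)) = f x}
  add_mem' := by
    intro f g hf hg i x
    rw [Smooth.coe_add, Pi.add_apply, Pi.add_apply, hf i x, hg i x]
  zero_mem' := fun _ _ => rfl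
  smul_mem' := by
    intro c f hf i x
    rw [Smooth.coe_smul, Pi.smul_apply, Pi.smul_apply, hf i x]

variable (d E) in
/-- The space of smooth, `2π`-periodic functions, with the subspace topology. -/
abbrev SmoothPeriodic := ↥(smoothPeriodicSubmodule d E)

variable [PolynormableSpace ℂ E]

/-- The point evaluation `f ↦ f x`. -/
def Smooth.evalAt (x : Fin d → ℝ) : Smooth d E →L[ℂ] E where
  toFun f := f x
  map_add' _ _ := rfl
  map_smul' _ _ := rfl
  cont := by
    refine Smooth.withSeminorms.continuous_of_isBounded (PolynormableSpace.withSeminorms ℂ E)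
      { toFun := fun f : Smooth d E => f x, map_add' := fun _ _ => rfl,
        map_smul' := fun _ _ => rfl : Smooth d E →ₗ[ℂ] E } ?_
    intro p
    refine ⟨{(⟨{x}, isCompact_singleton⟩, 0, p)}, 1, fun f => ?_⟩
    rw [Finset.sup_singleton, one_smul]
    have h := le_ciSup (f.bddAbove ⟨{x}, isCompact_singleton⟩ 0 p)
      (⟨x, Set.mem_singleton x⟩, ⟨0, by simp⟩)
    have h1 : multiDeriv (0 : Fin d → ℕ) f = f := by
      unfold multiDeriv
      induction (List.finRange d) with
      | nil => rfl
      | cons i l ih => simp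
    simp only [h1] at h
    exact h

/-- The point evaluation `f ↦ f x` on the periodic functions. -/
def SmoothPeriodic.evalAt (x : Fin d → ℝ) : SmoothPeriodic d E →L[ℂ] E :=
  (Smooth.evalAt x).comp (smoothPeriodicSubmodule d E).subtypeL

end Smooth

/-! ### Rapidly decreasing families -/

section Rapid

variable {d : ℕ} {E : Type*} [AddCommGroup E] [Module ℂ E] [TopologicalSpace E]

/-- The weight `(1 + |k|²)^{j/2}`, with the Euclidean norm `|k|`. -/
def weight (j : ℕ) (k : Fin d → ℤ) : ℝ := (1 + ∑ i, (k i : ℝ) ^ 2) ^ ((j : ℝ) / 2)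

theorem weight_nonneg (j : ℕ) (k : Fin d → ℤ) : 0 ≤ weight j k :=
  Real.rpow_nonneg (by positivity) _

theorem weight_zero (k : Fin d → ℤ) : weight 0 k = 1 := by simp [weight]

variable (d E) in
def rapidSubmodule : Submodule ℂ ((Fin d → ℤ) → E) where
  carrier := {x | ∀ (j : ℕ) (p : {p : Seminorm ℂ E // Continuous p}),
    BddAbove (Set.range fun k => p.1 (x k) * weight j k)}
  add_mem' := by
    intro x y hx hy j p
    obtain ⟨A, hA⟩ := hx j p
    obtain ⟨B, hB⟩ := hy j p
    refine ⟨A + B, ?_⟩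
    rintro _ ⟨k, rfl⟩
    refine (mul_le_mul_of_nonneg_right (map_add_le_add p.1 _ _) (weight_nonneg j k)).trans ?_
    rw [add_mul]
    exact add_le_add (hA ⟨k, rfl⟩) (hB ⟨k, rfl⟩)
  zero_mem' := by
    intro j p
    refine ⟨0, ?_⟩
    rintro _ ⟨k, rfl⟩
    simp
  smul_mem' := by
    intro c x hx j p
    obtain ⟨A, hA⟩ := hx j p
    refine ⟨‖c‖ * A, ?_⟩
    rintro _ ⟨k, rfl⟩
    simp only [Pi.smul_apply, map_smul_eq_mul, mul_assoc]
    exact mul_le_mul_of_nonneg_left (hA ⟨k, rfl⟩) (norm_nonneg _)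

variable (d E) in
/-- The space `s(ℤ^d, E)` of rapidly decreasing families. It is a type of its own, so that it does
not inherit the topology of pointwise convergence. -/
def Rapid : Type _ := ↥(rapidSubmodule d E)

instance : AddCommGroup (Rapid d E) := inferInstanceAs (AddCommGroup ↥(rapidSubmodule d E))

instance : Module ℂ (Rapid d E) := inferInstanceAs (Module ℂ ↥(rapidSubmodule d E))

instance : FunLike (Rapid d E) (Fin d → ℤ) E where
  coe x := x.1
  coe_injective _ _ h := Subtype.ext h

theorem Rapid.bddAbove (x : Rapid d E) (j : ℕ) (p : {p : Seminorm ℂ E // Continuous p}) :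
    BddAbove (Set.range fun k => p.1 (x k) * weight j k) := x.2 j p

theorem Rapid.coe_add (x y : Rapid d E) : ⇑(x + y) = ⇑x + ⇑y := rfl

theorem Rapid.coe_smul (c : ℂ) (x : Rapid d E) : ⇑(c • x) = c • ⇑x := rfl

theorem Rapid.coe_zero : ⇑(0 : Rapid d E) = 0 := rfl

/-- The seminorm `x ↦ sup {p (x k) (1 + |k|²)^{j/2} | k ∈ ℤ^d}`. -/
def Rapid.seminorm (j : ℕ) (p : {p : Seminorm ℂ E // Continuous p}) : Seminorm ℂ (Rapid d E) :=
  Seminorm.ofSMulLE (fun x => ⨆ k : Fin d → ℤ, p.1 (x k) * weight j k)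
    (by simp [Rapid.coe_zero])
    (by
      intro x y
      refine ciSup_le fun k => ?_
      refine (mul_le_mul_of_nonneg_right (map_add_le_add p.1 _ _) (weight_nonneg j k)).trans ?_
      rw [add_mul]
      exact add_le_add (le_ciSup (x.bddAbove j p) k) (le_ciSup (y.bddAbove j p) k))
    (by
      intro c x
      refine ciSup_le fun k => ?_
      rw [Rapid.coe_smul, Pi.smul_apply, map_smul_eq_mul, mul_assoc]
      exact mul_le_mul_of_nonneg_left (le_ciSup (x.bddAbove j p) k) (norm_nonneg _))

variable (d E) in
def Rapid.seminormFamily :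
    SeminormFamily ℂ (Rapid d E) (ℕ × {p : Seminorm ℂ E // Continuous p}) :=
  fun q => Rapid.seminorm q.1 q.2

instance : TopologicalSpace (Rapid d E) :=
  (Rapid.seminormFamily d E).moduleFilterBasis.topology

theorem Rapid.withSeminorms : WithSeminorms (Rapid.seminormFamily d E) := ⟨rfl⟩

/-- The point evaluation `x ↦ x n`. -/
def Rapid.evalAt [PolynormableSpace ℂ E] (n : Fin d → ℤ) : Rapid d E →L[ℂ] E where
  toFun x := x n
  map_add' _ _ := rfl
  map_smul' _ _ := rfl
  cont := by
    refine Rapid.withSeminorms.continuous_of_isBounded (PolynormableSpace.withSeminorms ℂ E)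
      { toFun := fun x : Rapid d E => x n, map_add' := fun _ _ => rfl,
        map_smul' := fun _ _ => rfl : Rapid d E →ₗ[ℂ] E } ?_
    intro p
    refine ⟨{(0, p)}, 1, fun x => ?_⟩
    rw [Finset.sup_singleton, one_smul]
    have h := le_ciSup (x.bddAbove 0 p) n
    rw [weight_zero, mul_one] at h
    exact h

end Rapid

/-! ### Fourier coefficients and the point evaluation maps `S` -/

section Fourier

variable {d : ℕ} {E : Type*} [AddCommGroup E] [Module ℂ E] [TopologicalSpace E]
  [IsTopologicalAddGroup E] [ContinuousConstSMul ℂ E] [T2Space E]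

variable (d) in
/-- The cube `[-π, π]^d`. -/
def cube : Set (Fin d → ℝ) := Set.Icc (fun _ => -Real.pi) (fun _ => Real.pi)

/-- The function `x ↦ f x * exp (-i ⟨n, x⟩)`. -/
def fourierIntegrand (f : SmoothPeriodic d E) (n : Fin d → ℤ) (x : Fin d → ℝ) : E :=
  Complex.exp (-(Complex.I * ((∑ i, (n i : ℝ) * x i : ℝ) : ℂ))) • f.1 x

/-- The `n`-th Fourier coefficient `(2π)^{-d} ∫_{[-π, π]^d} f x exp (-i ⟨n, x⟩) dx`. -/
def fourierCoeff (f : SmoothPeriodic d E) (n : Fin d → ℤ) : E :=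
  ((2 * (Real.pi : ℂ)) ^ d)⁻¹ • pettisIntegral volume (cube d) (fourierIntegrand f n)

/-- `T` is the Fourier coefficient map. -/
def IsFourierMap (T : SmoothPeriodic d E → Rapid d E) : Prop :=
  ∀ f n, T f n = fourierCoeff f n

/-- `S` is the map `u ↦ (x ↦ u (δ_x))` on the periodic smooth functions. -/
def IsSmoothEvalMap (S : EpsProd (SmoothPeriodic d ℂ) E → SmoothPeriodic d E) : Prop :=
  ∀ u x, (S u).1 x =
    u (ContinuousLinearMap.toUniformConvergenceCLM _ _ _ (SmoothPeriodic.evalAt x))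

/-- `S` is the map `u ↦ (n ↦ u (δ_n))` on the rapidly decreasing families. -/
def IsRapidEvalMap (S : EpsProd (Rapid d ℂ) E → Rapid d E) : Prop :=
  ∀ u n, S u n = u (ContinuousLinearMap.toUniformConvergenceCLM _ _ _ (Rapid.evalAt n))

end Fourier

end PeriodicFourier

end

open PeriodicFourier

noncomputable section

namespace PeriodicFourier

/-! ### Locally convex spaces -/

section LocallyConvex

variable {E : Type*} [AddCommGroup E] [Module ℂ E] [TopologicalSpace E] [PolynormableSpace ℂ E]

/-! Everything is reduced to scalars. By Hahn–Banach a continuous seminorm is the supremum of the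
moduli of the functionals it dominates (`exists_dual_le_seminorm`), so weak identities, and scalar
estimates uniform over such functionals, become vector-valued ones. Sequential completeness enters
through limits along sequences: Riemann sums of a continuous function converge to its Pettis
integral (`exists_hasPettisIntegral`), and absolutely summable families over `ℤ^d` are summable
(`summable_of_seminorm`).

The inverse of `𝔉^E` sums a rapidly decreasing family to a trigonometric series, which may be
differentiated termwise (`Rapid.hasPartialDerivAt_series`). Conversely, integration by parts in
single variables makes Fourier coefficients decay rapidly (`seminorm_fourierCoeff_mul_weight_le`).
The two maps are mutually inverse by orthogonality of the characters (`scalarCoeff_series`) and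
scalar inversion on the torus (`hasSum_scalarCoeff`), both tested against functionals. The same
estimates give continuity in both directions.

For `S` on `s(ℤ^d)`, every functional is `∑ f'(e_n) δ_n`, uniformly on compact sets
(`hasSum_smul_delta`), so `u` is recovered from the values `u(δ_n)`. A family `x` comes from `f' ↦ ∑
f'(e_n) x_n`, which is continuous for the `κ`-topology because boxes with rapidly decreasing sides
are compact (`isCompact_rapid_box`, `continuous_epsLinear`).

The evaluation map on periodic functions is obtained as the composite `(𝔉^E)⁻¹ ∘ S ∘ (𝔉^ℂ ε id)`.
Expanding `δ_t` along the characters shows that this composite really evaluates at `δ_t`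
(`isSmoothEvalMap_smoothEvalEquiv`), and the asserted factorization is then built in. -/

/-- On the line spanned by `v` the functional `c v ↦ c p(v)` is dominated by `p`; Hahn–Banach
extends it with the same bound. -/
theorem exists_dual_le_seminorm {p : Seminorm ℂ E} (hp : Continuous p) (v : E) :
    ∃ e' : E →L[ℂ] ℂ, (∀ x, ‖e' x‖ ≤ p x) ∧ ‖e' v‖ = p v := by
  by_cases hv : v = 0
  · exact ⟨0, fun x => by simp, by simp [hv]⟩
  let φ := (LinearEquiv.toSpanNonzeroSingleton ℂ E v hv).symm
  let f : Module.Dual ℂ (ℂ ∙ v) := ((p v : ℝ) : ℂ) • (φ : (ℂ ∙ v) →ₗ[ℂ] ℂ)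
  have hf : ∀ x, ‖f x‖ ≤ p x := by
    intro x
    obtain ⟨c, rfl⟩ := φ.symm.surjective x
    have h1 : f (φ.symm c) = (p v : ℂ) * c := by
      change (p v : ℂ) * φ (φ.symm c) = _
      rw [LinearEquiv.apply_symm_apply]
    have h2 : ((φ.symm c : (ℂ ∙ v)) : E) = c • v := rfl
    rw [h1, h2, map_smul_eq_mul, norm_mul, Complex.norm_real, Real.norm_of_nonneg (apply_nonneg p v),
      mul_comm]
  obtain ⟨g, hg, hle⟩ := f.exists_continuous_extension_of_le_seminorm _ hp hf
  refine ⟨g, hle, ?_⟩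
  have h1 : f (φ.symm 1) = (p v : ℂ) * 1 := by
    change (p v : ℂ) * φ (φ.symm 1) = _
    rw [LinearEquiv.apply_symm_apply]
  have h2 : ((φ.symm 1 : (ℂ ∙ v)) : E) = v := one_smul _ _
  have h3 := hg (φ.symm 1)
  rw [h2] at h3
  rw [h3, h1, mul_one, Complex.norm_real, Real.norm_of_nonneg (apply_nonneg p v)]

/-- The main tool for passing from scalar estimates to vector estimates: only functionals in the
polar of `p` have to be tested. -/
theorem seminorm_le_of_forall_dual {p : Seminorm ℂ E} (hp : Continuous p) {v : E} {C : ℝ}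
    (h : ∀ e' : E →L[ℂ] ℂ, (∀ x, ‖e' x‖ ≤ p x) → ‖e' v‖ ≤ C) : p v ≤ C := by
  obtain ⟨e', h1, h2⟩ := exists_dual_le_seminorm hp v
  exact h2 ▸ h e' h1

theorem eq_zero_of_forall_seminorm [T2Space E] {v : E}
    (h : ∀ p : Seminorm ℂ E, Continuous p → p v = 0) : v = 0 := by
  by_contra hv
  obtain ⟨p, hp⟩ := (PolynormableSpace.withSeminorms ℂ E).separating_of_T1 v hv
  exact hp (h p.1 p.2)

theorem eq_of_forall_dual [T2Space E] {a b : E} (h : ∀ e' : E →L[ℂ] ℂ, e' a = e' b) : a = b := by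
  rw [← sub_eq_zero]
  refine eq_zero_of_forall_seminorm fun p hp => le_antisymm ?_ (apply_nonneg _ _)
  refine seminorm_le_of_forall_dual hp fun e' _ => ?_
  rw [map_sub, h e', sub_self, norm_zero]

theorem tendsto_nhds_iff_seminorm {ι : Type*} {l : Filter ι} {u : ι → E} {a : E} :
    Tendsto u l (𝓝 a) ↔
      ∀ p : Seminorm ℂ E, Continuous p → Tendsto (fun i => p (u i - a)) l (𝓝 0) := by
  rw [(PolynormableSpace.withSeminorms ℂ E).tendsto_nhds]
  constructor
  · intro h p hp
    rw [Metric.tendsto_nhds]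
    intro ε hε
    filter_upwards [h ⟨p, hp⟩ ε hε] with i hi
    rwa [Real.dist_eq, sub_zero, abs_of_nonneg (apply_nonneg _ _)]
  · intro h p ε hε
    filter_upwards [(h p.1 p.2).eventually (gt_mem_nhds hε)] with i hi
    exact hi

theorem exists_seminorm_of_mem_nhds {U : Set E} {a : E} (hU : U ∈ 𝓝 a) :
    ∃ p : Seminorm ℂ E, Continuous p ∧ ∀ x, p (x - a) < 1 → x ∈ U := by
  obtain ⟨s, r, hr, h⟩ := ((PolynormableSpace.withSeminorms ℂ E).mem_nhds_iff a U).1 hU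
  have := (PolynormableSpace.withSeminorms ℂ E).topologicalAddGroup
  have := (PolynormableSpace.withSeminorms ℂ E).continuousSMul
  let q : Seminorm ℂ E := s.sup (fun p : {p : Seminorm ℂ E // Continuous p} => p.1)
  have hq : Continuous q := Seminorm.continuous_finsetSup fun i _ => i.2
  -- The finite supremum of continuous seminorms is again one; dividing it by the radius normalizes
  -- the ball to radius `1`.
  refine ⟨r⁻¹.toNNReal • q, Continuous.const_smul hq r⁻¹.toNNReal, fun x hx => h ?_⟩
  rw [Seminorm.mem_ball]
  have h1 : (r⁻¹.toNNReal : ℝ) * q (x - a) < 1 := hx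
  rwa [Real.coe_toNNReal _ (by positivity), inv_mul_lt_iff₀ hr, mul_one] at h1

theorem seminorm_sum_le {ι : Type*} (p : Seminorm ℂ E) (s : Finset ι) (x : ι → E) :
    p (∑ i ∈ s, x i) ≤ ∑ i ∈ s, p (x i) :=
  Finset.le_sum_of_subadditive p (map_zero p).le (map_add_le_add p) s x

theorem continuous_dual_norm (e' : E →L[ℂ] ℂ) : Continuous (e'.toSeminorm) := e'.continuous.norm

end LocallyConvex

/-! ### Cauchy nets and summability from seminorm estimates -/

section SequentiallyComplete

variable {E : Type*} [AddCommGroup E] [Module ℂ E] [UniformSpace E] [IsUniformAddGroup E]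
  [PolynormableSpace ℂ E]

/-- Comparison with the single index `N` is enough, by the triangle inequality. The index set is
general so that nets of finite partial sums are covered. -/
theorem cauchySeq_of_seminorm {ι : Type*} [SemilatticeSup ι] [Nonempty ι] {u : ι → E}
    (h : ∀ p : Seminorm ℂ E, Continuous p → ∀ ε > 0, ∃ N, ∀ n, N ≤ n → p (u n - u N) < ε) :
    CauchySeq u := by
  rw [cauchySeq_iff_tendsto, uniformity_eq_comap_nhds_zero, tendsto_comap_iff,
    tendsto_nhds_iff_seminorm]
  intro p hp
  rw [Metric.tendsto_nhds]
  intro ε hε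
  obtain ⟨N, hN⟩ := h p hp (ε / 2) (half_pos hε)
  filter_upwards [eventually_ge_atTop (N, N)] with ⟨m, n⟩ hmn
  have h1 := hN m hmn.1
  have h2 := hN n hmn.2
  rw [Real.dist_eq, sub_zero, abs_of_nonneg (apply_nonneg _ _), sub_zero]
  have h3 : u n - u m = (u n - u N) - (u m - u N) := by abel
  simp only [Function.comp_def, Prod.map]
  rw [h3]
  exact (map_sub_le_add p _ _).trans_lt (by linarith)

theorem summable_of_seminorm (hE : IsSequentiallyComplete E) {ι : Type*} [Countable ι] {x : ι → E}
    (h : ∀ p : Seminorm ℂ E, Continuous p → Summable fun i => p (x i)) : Summable x := by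
  have hc : CauchySeq (fun s : Finset ι => ∑ i ∈ s, x i) := by
    classical
    refine cauchySeq_of_seminorm fun p hp ε hε => ?_
    obtain ⟨s, hs⟩ := summable_iff_vanishing_norm.1 (h p hp) ε hε
    refine ⟨s, fun t hst => ?_⟩
    have h1 := hs (t \ s) Finset.sdiff_disjoint
    rw [← Finset.sum_sdiff hst, add_sub_cancel_right]
    refine lt_of_le_of_lt (seminorm_sum_le p _ _) ?_
    exact (le_abs_self _).trans_lt h1
  -- Since the index set is countable, some sequence of finite sets is cofinal. Sequential
  -- completeness gives a limit along it, and a Cauchy net with a convergent subsequence converges.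
  obtain ⟨s, hs⟩ := exists_seq_tendsto (atTop : Filter (Finset ι))
  obtain ⟨a, ha⟩ := hE _ (hc.comp_tendsto hs)
  exact ⟨a, tendsto_nhds_of_cauchySeq_of_subseq hc hs ha⟩

theorem seminorm_le_tsum {p : Seminorm ℂ E} (hp : Continuous p) {ι : Type*} {x : ι → E} {a : E}
    (h : HasSum x a) (hs : Summable fun i => p (x i)) : p a ≤ ∑' i, p (x i) := by
  refine le_of_tendsto_of_tendsto ((hp.tendsto a).comp h) hs.hasSum (Eventually.of_forall ?_)
  exact fun s => seminorm_sum_le p _ _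

end SequentiallyComplete

/-! ### Weights -/

section Weights

variable {d : ℕ}

theorem one_le_weight (j : ℕ) (k : Fin d → ℤ) : 1 ≤ weight j k :=
  Real.one_le_rpow (le_add_of_nonneg_right (Finset.sum_nonneg fun _ _ => sq_nonneg _))
    (by positivity)

theorem weight_pos (j : ℕ) (k : Fin d → ℤ) : 0 < weight j k :=
  zero_lt_one.trans_le (one_le_weight j k)

theorem weight_add (a b : ℕ) (k : Fin d → ℤ) : weight (a + b) k = weight a k * weight b k := by
  have h : (0 : ℝ) < 1 + ∑ i, (k i : ℝ) ^ 2 := by positivity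
  rw [weight, weight, weight, ← Real.rpow_add h]
  congr 1
  push_cast
  ring

theorem weight_mono {a b : ℕ} (h : a ≤ b) (k : Fin d → ℤ) : weight a k ≤ weight b k := by
  obtain ⟨c, rfl⟩ := Nat.exists_eq_add_of_le h
  rw [weight_add]
  exact le_mul_of_one_le_right (weight_nonneg _ _) (one_le_weight _ _)

theorem weight_two_mul (j : ℕ) (k : Fin d → ℤ) :
    weight (2 * j) k = (1 + ∑ i, (k i : ℝ) ^ 2) ^ j := by
  rw [weight, ← Real.rpow_natCast]
  congr 1
  push_cast
  ring

theorem weight_mul (a j : ℕ) (k : Fin d → ℤ) : weight (a * j) k = weight j k ^ a := by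
  induction a with
  | zero => rw [zero_mul, weight_zero, pow_zero]
  | succ a ih => rw [add_mul, one_mul, weight_add, ih, pow_succ]

theorem sq_le_sum_sq (k : Fin d → ℤ) (i : Fin d) : (k i : ℝ) ^ 2 ≤ ∑ i, (k i : ℝ) ^ 2 :=
  Finset.single_le_sum (f := fun i => (k i : ℝ) ^ 2) (fun _ _ => sq_nonneg _) (Finset.mem_univ i)

theorem abs_le_weight (k : Fin d → ℤ) (i : Fin d) : |(k i : ℝ)| ≤ weight 1 k := by
  refine abs_le_of_sq_le_sq ?_ (weight_nonneg _ _)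
  rw [← weight_mul, mul_comm, weight_mul, pow_one, ← mul_one 2, weight_two_mul, pow_one]
  simp only [mul_one]
  linarith [sq_le_sum_sq k i]

theorem summable_prod_inv (d : ℕ) :
    Summable fun k : Fin d → ℤ => ∏ i, (1 + (k i : ℝ) ^ 2)⁻¹ := by
  have h1 : Summable fun n : ℤ => (1 + (n : ℝ) ^ 2)⁻¹ := by
    refine Summable.of_norm_bounded_eventually
      (Real.summable_one_div_int_pow.2 (one_lt_two)) ?_
    filter_upwards [(Set.finite_singleton (0 : ℤ)).compl_mem_cofinite] with n hn
    have hn : (n : ℝ) ≠ 0 := by exact_mod_cast hn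
    rw [Real.norm_of_nonneg (by positivity), one_div]
    exact inv_anti₀ (by positivity) (by linarith)
  induction d with
  | zero => exact (hasSum_fintype _).summable
  | succ d ih =>
    -- Splitting off the first coordinate turns the family into a product of two nonnegative
    -- summable families.
    rw [← (Fin.consEquiv fun _ : Fin (d + 1) => ℤ).summable_iff]
    refine (h1.mul_of_nonneg ih (fun _ => by positivity) (fun _ => by
      change (0 : ℝ) ≤ _
      positivity)).congr fun k => ?_
    simp [Fin.consEquiv, Fin.prod_univ_succ, mul_comm]

/-- Each factor `1 + k_i²` is at most `1 + |k|²`, so the inverse weight of order `2d` lies below the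
summable product. -/
theorem summable_weight_inv (d : ℕ) : Summable fun k : Fin d → ℤ => (weight (2 * d) k)⁻¹ := by
  refine (summable_prod_inv d).of_nonneg_of_le (fun k => inv_nonneg.2 (weight_nonneg _ _))
    fun k => ?_
  rw [Finset.prod_inv_distrib]
  refine inv_anti₀ (Finset.prod_pos fun i _ => by positivity) ?_
  rw [weight_two_mul]
  refine (Finset.prod_le_prod (g := fun _ => 1 + ∑ i, (k i : ℝ) ^ 2) (fun i _ => by positivity)
    fun i _ => ?_).trans_eq (by rw [Finset.prod_const, Finset.card_fin])
  linarith [sq_le_sum_sq k i]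

/-- The sum of the inverse weights `(1 + |k|²)^{-d}`. -/
def weightSum (d : ℕ) : ℝ := ∑' k : Fin d → ℤ, (weight (2 * d) k)⁻¹

theorem weightSum_nonneg (d : ℕ) : 0 ≤ weightSum d :=
  tsum_nonneg fun _ => inv_nonneg.2 (weight_nonneg _ _)

theorem tendsto_weight_inv (d : ℕ) :
    Tendsto (fun k : Fin d → ℤ => (weight (2 * d) k)⁻¹) cofinite (𝓝 0) :=
  (summable_weight_inv d).tendsto_cofinite_zero

/-- Giving up `2d` orders of decay buys a summable factor; this is how supremum bounds become bounds
for sums. -/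
theorem le_div_weight {a C : ℝ} {j : ℕ} {k : Fin d → ℤ} (h : a * weight (j + 2 * d) k ≤ C) :
    a * weight j k ≤ C * (weight (2 * d) k)⁻¹ := by
  rwa [← div_eq_mul_inv, le_div_iff₀ (weight_pos _ _), mul_assoc, ← weight_add]

theorem summable_mul_weight {a : (Fin d → ℤ) → ℝ} (h0 : ∀ k, 0 ≤ a k) {j : ℕ} {C : ℝ}
    (h : ∀ k, a k * weight (j + 2 * d) k ≤ C) : Summable fun k => a k * weight j k :=
  ((summable_weight_inv d).mul_left C).of_nonneg_of_le
    (fun k => mul_nonneg (h0 k) (weight_nonneg _ _)) fun k => le_div_weight (h k)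

theorem tsum_mul_weight_le {a : (Fin d → ℤ) → ℝ} (h0 : ∀ k, 0 ≤ a k) {j : ℕ} {C : ℝ}
    (h : ∀ k, a k * weight (j + 2 * d) k ≤ C) : ∑' k, a k * weight j k ≤ C * weightSum d := by
  rw [weightSum, ← tsum_mul_left]
  exact (summable_mul_weight h0 h).tsum_le_tsum (fun k => le_div_weight (h k))
    ((summable_weight_inv d).mul_left C)

/-- Weights are dominated by the powers of the single coordinates. -/
theorem weight_le_sum_pow (j : ℕ) (k : Fin d → ℤ) :
    weight j k ≤ ((d : ℝ) + 1) ^ j * (1 + ∑ i, |(k i : ℝ)| ^ (2 * j)) := by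
  have h1 : weight j k ≤ (1 + ∑ i, (k i : ℝ) ^ 2) ^ j := by
    rw [← weight_two_mul]
    exact weight_mono (by omega) k
  refine h1.trans ?_
  obtain rfl | hj := Nat.eq_zero_or_pos j
  · simp
  obtain ⟨n, rfl⟩ := Nat.exists_eq_add_of_le' hj
  -- Power mean inequality for the `d + 1` numbers `1, k_1², …, k_d²`, indexed by `Option (Fin d)`.
  -- It yields the constant `(d + 1)^(j - 1)`, which is relaxed to `(d + 1)^j` at the end; hence the
  -- separate case `j = 0`.
  have h3 := pow_sum_div_card_le_sum_pow (s := (Finset.univ : Finset (Option (Fin d))))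
    (f := fun o => o.elim 1 fun i => (k i : ℝ) ^ 2) (n := n) (by
      rintro (_ | i) -
      · exact zero_le_one
      · exact sq_nonneg _)
  rw [Fintype.sum_option, Fintype.sum_option, Finset.card_univ, Fintype.card_option,
    Fintype.card_fin, div_le_iff₀ (by positivity)] at h3
  simp only [Option.elim, one_pow] at h3
  refine h3.trans ?_
  rw [mul_comm]
  have h4 : ∀ i, ((k i : ℝ) ^ 2) ^ (n + 1) = |(k i : ℝ)| ^ (2 * (n + 1)) := fun i => by
    rw [pow_mul, sq_abs]
  simp only [h4]
  refine mul_le_mul_of_nonneg_right ?_ (by positivity)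
  push_cast
  exact pow_le_pow_right₀ (by linarith [Nat.cast_nonneg (α := ℝ) d]) (Nat.le_succ n)

end Weights

/-! ### Basic bounds for rapidly decreasing families -/

section RapidBasic

variable {d : ℕ} {E : Type*} [AddCommGroup E] [Module ℂ E] [TopologicalSpace E]

theorem Rapid.ext {x y : Rapid d E} (h : ∀ k, x k = y k) : x = y := DFunLike.ext x y h

theorem Rapid.le_seminorm (j : ℕ) {p : Seminorm ℂ E} (hp : Continuous p) (x : Rapid d E)
    (k : Fin d → ℤ) : p (x k) * weight j k ≤ Rapid.seminorm j ⟨p, hp⟩ x :=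
  le_ciSup (x.bddAbove j ⟨p, hp⟩) k

theorem Rapid.seminorm_le (j : ℕ) {p : Seminorm ℂ E} (hp : Continuous p) (x : Rapid d E) {C : ℝ}
    (h : ∀ k, p (x k) * weight j k ≤ C) : Rapid.seminorm j ⟨p, hp⟩ x ≤ C :=
  ciSup_le h

theorem Rapid.continuous_seminorm (j : ℕ) {p : Seminorm ℂ E} (hp : Continuous p) :
    Continuous (Rapid.seminorm (d := d) j ⟨p, hp⟩) :=
  Rapid.withSeminorms.continuous_seminorm (j, ⟨p, hp⟩)

/-- Construct a rapidly decreasing family from bounds. -/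
def Rapid.mk (x : (Fin d → ℤ) → E) (h : ∀ (j : ℕ) (p : Seminorm ℂ E), Continuous p →
    ∃ C, ∀ k, p (x k) * weight j k ≤ C) : Rapid d E :=
  ⟨x, fun j p => by
    obtain ⟨C, hC⟩ := h j p.1 p.2
    exact ⟨C, by rintro _ ⟨k, rfl⟩; exact hC k⟩⟩

theorem Rapid.mk_apply (x : (Fin d → ℤ) → E) (h) (k : Fin d → ℤ) : Rapid.mk x h k = x k := rfl

instance : IsTopologicalAddGroup (Rapid d E) := Rapid.withSeminorms.topologicalAddGroup

instance : PolynormableSpace ℂ (Rapid d E) := Rapid.withSeminorms.toPolynormableSpace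

end RapidBasic

/-! ### Characters and trigonometric series -/

section Character

variable {d : ℕ}

/-- The character `t ↦ exp (i ⟨k, t⟩)`. -/
def character (k : Fin d → ℤ) (t : Fin d → ℝ) : ℂ :=
  Complex.exp (Complex.I * ((∑ i, (k i : ℝ) * t i : ℝ) : ℂ))

theorem norm_character (k : Fin d → ℤ) (t : Fin d → ℝ) : ‖character k t‖ = 1 := by
  rw [character, mul_comm, Complex.norm_exp_ofReal_mul_I]

theorem continuous_character (k : Fin d → ℤ) : Continuous (character k) := by
  unfold character
  fun_prop

theorem character_neg (k : Fin d → ℤ) (t : Fin d → ℝ) :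
    character (-k) t = Complex.exp (-(Complex.I * ((∑ i, (k i : ℝ) * t i : ℝ) : ℂ))) := by
  rw [character]
  congr 1
  simp

theorem character_add_single (k : Fin d → ℤ) (t : Fin d → ℝ) (i : Fin d) (h : ℝ) :
    character k (t + Pi.single i h) =
      Complex.exp (Complex.I * (((k i : ℝ) * h : ℝ) : ℂ)) * character k t := by
  have h1 : ∑ j, (k j : ℝ) * (t + Pi.single i h : Fin d → ℝ) j = (k i : ℝ) * h + ∑ j, (k j : ℝ) * t j := by
    simp only [Pi.add_apply, mul_add, Finset.sum_add_distrib]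
    rw [Finset.sum_eq_single i (f := fun j => (k j : ℝ) * (Pi.single i h : Fin d → ℝ) j)]
    · rw [Pi.single_eq_same, add_comm]
    · intro j _ hj
      rw [Pi.single_eq_of_ne hj, mul_zero]
    · simp
  rw [character, character, h1, ← Complex.exp_add]
  push_cast
  ring_nf

theorem character_periodic (k : Fin d → ℤ) (t : Fin d → ℝ) (i : Fin d) :
    character k (t + Pi.single i (2 * Real.pi)) = character k t := by
  have h1 : Complex.I * (((k i : ℝ) * (2 * Real.pi) : ℝ) : ℂ) =
      (k i : ℂ) * (2 * Real.pi * Complex.I) := by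
    push_cast
    ring
  rw [character_add_single, h1, Complex.exp_int_mul_two_pi_mul_I, one_mul]

/-- Taylor's bound covers `|x| ≤ 1`; for larger `|x|` the trivial bound `2|x|` is at most `2x²`. A
global bound is needed because it is applied with `x = k_i h` for all `k` at once. -/
theorem norm_exp_sub_one_sub_le (x : ℝ) :
    ‖Complex.exp (Complex.I * x) - 1 - Complex.I * x‖ ≤ 2 * x ^ 2 := by
  have hx : ‖Complex.I * (x : ℂ)‖ = |x| := by simp
  obtain h | h := le_total |x| 1
  · refine (Complex.norm_exp_sub_one_sub_id_le (hx.trans_le h)).trans ?_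
    rw [hx, sq_abs]
    linarith [sq_nonneg x]
  · refine (norm_sub_le _ _).trans ?_
    have h1 := Real.norm_exp_I_mul_ofReal_sub_one_le (x := x)
    rw [Real.norm_eq_abs] at h1
    rw [hx, ← sq_abs]
    nlinarith

/-- The difference quotients of the characters converge at a linear rate. -/
theorem norm_differenceQuotient_character_le (k : Fin d → ℤ) (t : Fin d → ℝ) (i : Fin d) {h : ℝ}
    (hh : h ≠ 0) :
    ‖(h : ℂ)⁻¹ * (character k (t + Pi.single i h) - character k t) -
      character k t * (Complex.I * (k i : ℂ))‖ ≤ |h| * (2 * weight 2 k) := by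
  have hh' : (h : ℂ) ≠ 0 := by exact_mod_cast hh
  have h1 : (h : ℂ)⁻¹ * (character k (t + Pi.single i h) - character k t) -
      character k t * (Complex.I * (k i : ℂ)) = (h : ℂ)⁻¹ * character k t *
      (Complex.exp (Complex.I * (((k i : ℝ) * h : ℝ) : ℂ)) - 1 -
        Complex.I * (((k i : ℝ) * h : ℝ) : ℂ)) := by
    rw [character_add_single]
    push_cast
    field_simp
  rw [h1, norm_mul, norm_mul, norm_character, mul_one, norm_inv, Complex.norm_real,
    Real.norm_eq_abs, inv_mul_le_iff₀ (abs_pos.2 hh)]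
  refine (norm_exp_sub_one_sub_le _).trans ?_
  have h2 : (k i : ℝ) ^ 2 ≤ weight 2 k := by
    rw [← mul_one 2, weight_two_mul, pow_one, mul_one]
    linarith [sq_le_sum_sq k i]
  rw [mul_pow, ← sq_abs h]
  nlinarith [sq_nonneg |h|]

end Character

/-! ### Termwise differentiation of trigonometric series -/

section Series

variable {d : ℕ} {E : Type*} [AddCommGroup E] [Module ℂ E]

section Top

variable [TopologicalSpace E]

theorem Rapid.summable_mul_weight {p : Seminorm ℂ E} (hp : Continuous p) (x : Rapid d E) (j : ℕ) :
    Summable fun k => p (x k) * weight j k :=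
  PeriodicFourier.summable_mul_weight (fun _ => apply_nonneg _ _) (x.le_seminorm _ hp)

theorem Rapid.summable_seminorm {p : Seminorm ℂ E} (hp : Continuous p) (x : Rapid d E) :
    Summable fun k => p (x k) := by
  simpa only [weight_zero, mul_one] using x.summable_mul_weight hp 0

theorem Rapid.tsum_seminorm_le {p : Seminorm ℂ E} (hp : Continuous p) (x : Rapid d E) :
    ∑' k, p (x k) ≤ Rapid.seminorm (2 * d) ⟨p, hp⟩ x * weightSum d := by
  have h := tsum_mul_weight_le (j := 0) (fun _ => apply_nonneg p _)
    (x.le_seminorm (0 + 2 * d) hp)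
  simpa only [weight_zero, mul_one, zero_add] using h

/-- The coefficients of the partial derivative of a trigonometric series. -/
def Rapid.deriv (i : Fin d) (x : Rapid d E) : Rapid d E :=
  Rapid.mk (fun k => (Complex.I * (k i : ℂ)) • x k) fun j p hp =>
    ⟨Rapid.seminorm (1 + j) ⟨p, hp⟩ x, fun k => by
      refine le_trans ?_ (x.le_seminorm (1 + j) hp k)
      rw [map_smul_eq_mul, weight_add, mul_comm _ (p (x k)), mul_assoc]
      refine mul_le_mul_of_nonneg_left ?_ (apply_nonneg _ _)
      refine mul_le_mul_of_nonneg_right ?_ (weight_nonneg _ _)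
      simpa using abs_le_weight k i⟩

theorem Rapid.deriv_apply (i : Fin d) (x : Rapid d E) (k : Fin d → ℤ) :
    x.deriv i k = (Complex.I * (k i : ℂ)) • x k := rfl

theorem Rapid.seminorm_deriv_apply_le (p : Seminorm ℂ E) (i : Fin d) (x : Rapid d E)
    (k : Fin d → ℤ) : p (x.deriv i k) ≤ weight 1 k * p (x k) := by
  rw [Rapid.deriv_apply, map_smul_eq_mul]
  refine mul_le_mul_of_nonneg_right ?_ (apply_nonneg _ _)
  simpa using abs_le_weight k i

/-- The sum of the trigonometric series with coefficients `x`. -/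
def Rapid.series (x : Rapid d E) (t : Fin d → ℝ) : E := ∑' k, character k t • x k

end Top

variable [UniformSpace E] [IsUniformAddGroup E] [ContinuousSMul ℂ E] [T2Space E]
  [PolynormableSpace ℂ E]

theorem Rapid.hasSum_smul (hE : IsSequentiallyComplete E) (x : Rapid d E)
    {c : (Fin d → ℤ) → ℂ} (hc : ∀ k, ‖c k‖ ≤ 1) :
    HasSum (fun k => c k • x k) (∑' k, c k • x k) := by
  refine (summable_of_seminorm hE fun p hp => ?_).hasSum
  refine (x.summable_seminorm hp).of_nonneg_of_le (fun _ => apply_nonneg _ _) fun k => ?_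
  rw [map_smul_eq_mul]
  exact mul_le_of_le_one_left (apply_nonneg _ _) (hc k)

theorem Rapid.hasSum_series (hE : IsSequentiallyComplete E) (x : Rapid d E) (t : Fin d → ℝ) :
    HasSum (fun k => character k t • x k) (x.series t) :=
  x.hasSum_smul hE fun k => (norm_character k t).le

theorem Rapid.seminorm_series_le (hE : IsSequentiallyComplete E) {p : Seminorm ℂ E}
    (hp : Continuous p) (x : Rapid d E) (t : Fin d → ℝ) : p (x.series t) ≤ ∑' k, p (x k) := by
  have h := seminorm_le_tsum hp (x.hasSum_series hE t)
  simp only [map_smul_eq_mul, norm_character, one_mul] at h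
  exact h (x.summable_seminorm hp)

/-- The `p`-distance of two values is at most `∑ |e_k(t) - e_k(t₀)| p(x_k)`, which tends to `0` by
dominated convergence with majorant `2 p(x_k)`. -/
theorem Rapid.continuous_series (hE : IsSequentiallyComplete E) (x : Rapid d E) :
    Continuous x.series := by
  refine continuous_iff_continuousAt.2 fun t₀ => tendsto_nhds_iff_seminorm.2 fun p hp => ?_
  have h1 : Tendsto (fun t => ∑' k, ‖character k t - character k t₀‖ * p (x k)) (𝓝 t₀)
      (𝓝 (∑' _ : Fin d → ℤ, (0 : ℝ))) := by
    refine tendsto_tsum_of_dominated_convergence ((x.summable_seminorm hp).mul_left 2)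
      (fun k => ?_) (Eventually.of_forall fun t k => ?_)
    · have h2 : Tendsto (fun t => ‖character k t - character k t₀‖ * p (x k)) (𝓝 t₀)
          (𝓝 (‖character k t₀ - character k t₀‖ * p (x k))) :=
        ((((continuous_character k).tendsto t₀).sub_const _).norm).mul_const _
      simpa using h2
    · rw [Real.norm_of_nonneg (by positivity)]
      refine mul_le_mul_of_nonneg_right ((norm_sub_le _ _).trans ?_) (apply_nonneg _ _)
      rw [norm_character, norm_character]
      norm_num
  rw [tsum_zero] at h1
  refine squeeze_zero (fun _ => apply_nonneg _ _) (fun t => ?_) h1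
  have h3 := (x.hasSum_series hE t).sub (x.hasSum_series hE t₀)
  simp only [← sub_smul] at h3
  refine (seminorm_le_tsum hp h3 ?_).trans_eq ?_
  · refine ((x.summable_seminorm hp).mul_left 2).of_nonneg_of_le (fun _ => apply_nonneg _ _)
      fun k => ?_
    rw [map_smul_eq_mul]
    refine mul_le_mul_of_nonneg_right ((norm_sub_le _ _).trans ?_) (apply_nonneg _ _)
    rw [norm_character, norm_character]
    norm_num
  · simp only [map_smul_eq_mul]

/-- The termwise errors of the difference quotients sum to at most `|h| ∑ 2 p(x_k) (1 + |k|²)`, and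
this sum is finite by rapid decay. -/
theorem Rapid.hasPartialDerivAt_series (hE : IsSequentiallyComplete E) (x : Rapid d E) (i : Fin d)
    (t : Fin d → ℝ) : HasPartialDerivAt x.series i ((x.deriv i).series t) t := by
  refine tendsto_nhds_iff_seminorm.2 fun p hp => ?_
  have h1 : Tendsto (fun h : ℝ => |h| * ∑' k, 2 * (p (x k) * weight 2 k)) (𝓝[≠] 0) (𝓝 0) := by
    have h2 : Tendsto (fun h : ℝ => |h| * ∑' k, 2 * (p (x k) * weight 2 k)) (𝓝 0)
        (𝓝 (|0| * ∑' k, 2 * (p (x k) * weight 2 k))) :=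
      (continuous_abs.tendsto 0).mul_const _
    rw [abs_zero, zero_mul] at h2
    exact h2.mono_left nhdsWithin_le_nhds
  refine squeeze_zero' (Eventually.of_forall fun _ => apply_nonneg _ _) ?_ h1
  filter_upwards [self_mem_nhdsWithin] with h hh
  have h3 := (((x.hasSum_series hE (t + Pi.single i h)).sub (x.hasSum_series hE t)).const_smul
    (h : ℂ)⁻¹).sub ((x.deriv i).hasSum_series hE t)
  have h4 : ∀ k, p ((h : ℂ)⁻¹ • (character k (t + Pi.single i h) • x k - character k t • x k) -
      character k t • x.deriv i k) ≤ |h| * (2 * (p (x k) * weight 2 k)) := fun k => by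
    rw [Rapid.deriv_apply, ← sub_smul, smul_smul, smul_smul, ← sub_smul, map_smul_eq_mul]
    refine (mul_le_mul_of_nonneg_right (norm_differenceQuotient_character_le k t i hh)
      (apply_nonneg _ _)).trans_eq ?_
    ring
  have hs : Summable fun k => |h| * (2 * (p (x k) * weight 2 k)) :=
    ((x.summable_mul_weight hp 2).mul_left 2).mul_left |h|
  have hs' := hs.of_nonneg_of_le (fun _ => apply_nonneg _ _) h4
  refine (seminorm_le_tsum hp h3 hs').trans ?_
  rw [← tsum_mul_left]
  exact hs'.tsum_le_tsum h4 hs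

theorem Rapid.partialDeriv_series (hE : IsSequentiallyComplete E) (x : Rapid d E) (i : Fin d) :
    partialDeriv i x.series = (x.deriv i).series :=
  funext fun t => (x.hasPartialDerivAt_series hE i t).partialDeriv_eq

theorem Rapid.isSmooth_series (hE : IsSequentiallyComplete E) (x : Rapid d E) :
    IsSmooth x.series := by
  intro k
  induction k generalizing x with
  | zero => exact x.continuous_series hE
  | succ k ih =>
    refine ⟨fun i => ⟨fun t => ⟨_, x.hasPartialDerivAt_series hE i t⟩, ?_⟩, fun i => ?_⟩ <;>
      rw [x.partialDeriv_series hE]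
    · exact (x.deriv i).continuous_series hE
    · exact ih _

theorem Rapid.iterate_partialDeriv_series (hE : IsSequentiallyComplete E) (x : Rapid d E)
    (i : Fin d) (n : ℕ) : (partialDeriv i)^[n] x.series = ((Rapid.deriv i)^[n] x).series := by
  induction n generalizing x with
  | zero => rfl
  | succ n ih => rw [Function.iterate_succ_apply, Function.iterate_succ_apply,
      x.partialDeriv_series hE, ih]

theorem Rapid.seminorm_iterate_deriv_apply_le (p : Seminorm ℂ E) (i : Fin d) (n : ℕ)
    (x : Rapid d E) (k : Fin d → ℤ) :
    p ((Rapid.deriv i)^[n] x k) ≤ weight n k * p (x k) := by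
  induction n generalizing x with
  | zero => rw [weight_zero, one_mul]; rfl
  | succ n ih =>
    rw [Function.iterate_succ_apply, weight_add, mul_assoc]
    exact (ih _).trans (mul_le_mul_of_nonneg_left (x.seminorm_deriv_apply_le p i k)
      (weight_nonneg _ _))

theorem Rapid.exists_multiDeriv_series (hE : IsSequentiallyComplete E) (x : Rapid d E)
    (β : Fin d → ℕ) : ∃ y : Rapid d E, multiDeriv β x.series = y.series ∧
      ∀ (p : Seminorm ℂ E) k, p (y k) ≤ weight (∑ i, β i) k * p (x k) := by
  -- With `∑ β_i` written as a sum over the list that defines the iterated derivative, one list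
  -- induction handles derivative and exponent together.
  rw [← List.sum_ofFn, List.ofFn_eq_map]
  unfold multiDeriv
  induction List.finRange d with
  | nil => exact ⟨x, rfl, fun p k => by simp [weight_zero]⟩
  | cons i l ih =>
    obtain ⟨y, hy, hp⟩ := ih
    refine ⟨(Rapid.deriv i)^[β i] y, ?_, fun p k => ?_⟩
    · rw [List.foldr_cons, hy, y.iterate_partialDeriv_series hE]
    · rw [List.map_cons, List.sum_cons, weight_add, mul_assoc]
      exact (y.seminorm_iterate_deriv_apply_le p i _ k).trans
        (mul_le_mul_of_nonneg_left (hp p k) (weight_nonneg _ _))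

theorem Rapid.series_periodic (x : Rapid d E) (i : Fin d) (t : Fin d → ℝ) :
    x.series (t + Pi.single i (2 * Real.pi)) = x.series t := by
  simp only [Rapid.series, character_periodic]

/-- The periodic smooth function with the Fourier coefficients `x`. -/
def Rapid.toSmoothPeriodic (hE : IsSequentiallyComplete E) (x : Rapid d E) : SmoothPeriodic d E :=
  ⟨⟨x.series, x.isSmooth_series hE⟩, fun i t => x.series_periodic i t⟩

/-- The bound does not depend on `K`, as characters have modulus one. Differentiating costs `l`
orders of decay and summing costs `2d`. -/
theorem Rapid.seminorm_toSmoothPeriodic_le (hE : IsSequentiallyComplete E) (x : Rapid d E)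
    (K : TopologicalSpace.Compacts (Fin d → ℝ)) (l : ℕ) {p : Seminorm ℂ E} (hp : Continuous p) :
    Smooth.seminorm K l ⟨p, hp⟩ (x.toSmoothPeriodic hE).1 ≤
      weightSum d * Rapid.seminorm (l + 2 * d) ⟨p, hp⟩ x := by
  refine Real.iSup_le (fun z => ?_) (mul_nonneg (weightSum_nonneg d) (apply_nonneg _ _))
  obtain ⟨y, hy, hle⟩ := x.exists_multiDeriv_series hE z.2.1
  change p (multiDeriv z.2.1 x.series z.1.1) ≤ _
  rw [hy]
  refine (y.seminorm_series_le hE hp _).trans ((y.tsum_seminorm_le hp).trans ?_)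
  rw [mul_comm]
  refine mul_le_mul_of_nonneg_left (y.seminorm_le _ hp fun k => ?_) (weightSum_nonneg d)
  refine le_trans ?_ (x.le_seminorm _ hp k)
  rw [weight_add, ← mul_assoc, mul_comm (p (x k))]
  refine mul_le_mul_of_nonneg_right ((hle p k).trans ?_) (weight_nonneg _ _)
  exact mul_le_mul_of_nonneg_right (weight_mono z.2.2 k) (apply_nonneg _ _)

end Series

/-! ### Pettis integrability of continuous functions -/

section Pettis

theorem isCompact_cube (d : ℕ) : IsCompact (cube d) := isCompact_Icc

theorem measurableSet_cube (d : ℕ) : MeasurableSet (cube d) := measurableSet_Icc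

variable {d : ℕ}

/-- The grid point with mesh size `1 / (N + 1)` below `x`. -/
def gridPoint (N : ℕ) (v : Fin d → ℤ) : Fin d → ℝ := fun i => (v i : ℝ) / ((N : ℝ) + 1)

def gridIndex (N : ℕ) (x : Fin d → ℝ) : Fin d → ℤ := fun i => ⌊((N : ℝ) + 1) * x i⌋

theorem measurable_gridIndex (N : ℕ) : Measurable (gridIndex (d := d) N) :=
  measurable_pi_lambda _ fun i => Int.measurable_floor.comp
    ((measurable_pi_apply i).const_mul _)

theorem dist_gridPoint_le (N : ℕ) (x : Fin d → ℝ) :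
    dist (gridPoint N (gridIndex N x)) x ≤ 1 / ((N : ℝ) + 1) := by
  have hN : (0 : ℝ) < (N : ℝ) + 1 := by positivity
  refine (dist_pi_le_iff (by positivity)).2 fun i => ?_
  have h1 := Int.floor_le (((N : ℝ) + 1) * x i)
  have h2 := Int.lt_floor_add_one (((N : ℝ) + 1) * x i)
  rw [Real.dist_eq, abs_le]
  simp only [gridPoint, gridIndex]
  constructor
  · rw [neg_le_sub_iff_le_add, ← add_div, le_div_iff₀ hN]
    linarith
  · have h3 : (1 / ((N : ℝ) + 1) + x i) * ((N : ℝ) + 1) = 1 + ((N : ℝ) + 1) * x i := by field_simp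
    rw [sub_le_iff_le_add, div_le_iff₀ hN, h3]
    linarith

theorem finite_image_gridIndex (N : ℕ) : (gridIndex N '' cube d).Finite := by
  refine (Set.finite_Icc (gridIndex N fun _ : Fin d => -Real.pi)
    (gridIndex N fun _ => Real.pi)).subset ?_
  rintro _ ⟨x, hx, rfl⟩
  have hN : (0 : ℝ) ≤ (N : ℝ) + 1 := by positivity
  exact ⟨fun i => Int.floor_le_floor (mul_le_mul_of_nonneg_left (hx.1 i) hN),
    fun i => Int.floor_le_floor (mul_le_mul_of_nonneg_left (hx.2 i) hN)⟩

variable {E : Type*} [AddCommGroup E] [Module ℂ E]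

/-- A Riemann sum for the integral of `f` over the cube. -/
def riemannSum (f : (Fin d → ℝ) → E) (N : ℕ) : E :=
  ∑ v ∈ (finite_image_gridIndex (d := d) N).toFinset,
    (((volume.restrict (cube d)).real (gridIndex N ⁻¹' {v}) : ℝ) : ℂ) • f (gridPoint N v)

instance : IsFiniteMeasure (volume.restrict (cube d)) :=
  isFiniteMeasure_restrict.2 (isCompact_cube d).measure_lt_top.ne

/-- The Riemann sum is the integral of a step function. No regularity of `g` is needed: only
finitely many measurable cells meet the cube. -/
theorem riemannSum_eq_integral (g : (Fin d → ℝ) → ℂ) (N : ℕ) :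
    Integrable (fun x => g (gridPoint N (gridIndex N x))) (volume.restrict (cube d)) ∧
      riemannSum g N = ∫ x in cube d, g (gridPoint N (gridIndex N x)) := by
  let V := (finite_image_gridIndex (d := d) N).toFinset
  have hm : ∀ v : Fin d → ℤ, MeasurableSet (gridIndex N ⁻¹' {v}) := fun v =>
    measurable_gridIndex N (measurableSet_singleton v)
  have hi : ∀ v ∈ V, Integrable ((gridIndex N ⁻¹' {v}).indicator fun _ => g (gridPoint N v))
      (volume.restrict (cube d)) := fun v _ => (integrable_const _).indicator (hm v)
  have h1 : (fun x => ∑ v ∈ V, (gridIndex N ⁻¹' {v}).indicator (fun _ => g (gridPoint N v)) x)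
      =ᵐ[volume.restrict (cube d)] fun x => g (gridPoint N (gridIndex N x)) := by
    filter_upwards [ae_restrict_mem (measurableSet_cube d)] with x hx
    rw [Finset.sum_eq_single (gridIndex N x)]
    · rw [Set.indicator_of_mem (by simp)]
    · intro v _ hv
      rw [Set.indicator_of_notMem]
      exact fun h => hv h.symm
    · intro h
      exact absurd ((finite_image_gridIndex (d := d) N).mem_toFinset.2 ⟨x, hx, rfl⟩) h
  refine ⟨(integrable_finsetSum V hi).congr h1, ?_⟩
  rw [← integral_congr_ae h1, integral_finsetSum V hi, riemannSum]
  refine Finset.sum_congr rfl fun v _ => ?_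
  rw [integral_indicator_const _ (hm v), Complex.real_smul, smul_eq_mul]

variable [UniformSpace E] [IsUniformAddGroup E] [ContinuousSMul ℂ E] [T2Space E]
  [PolynormableSpace ℂ E]

theorem exists_forall_seminorm_gridPoint_sub_le {f : (Fin d → ℝ) → E} (hf : Continuous f)
    {p : Seminorm ℂ E} (hp : Continuous p) {ε : ℝ} (hε : 0 < ε) :
    ∃ N₀, ∀ N ≥ N₀, ∀ x ∈ cube d, p (f (gridPoint N (gridIndex N x)) - f x) ≤ ε := by
  -- Grid points may leave the cube, so uniform continuity is used on its closed `1`-neighbourhood;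
  -- the minimum with `1` below keeps them inside it.
  have hK := (isCompact_cube d).cthickening (r := 1)
  have hu := hK.uniformContinuousOn_of_continuous hf.continuousOn
  have hent : {z : E × E | p (z.2 - z.1) < ε} ∈ uniformity E := by
    rw [uniformity_eq_comap_nhds_zero]
    refine ⟨{v | p v < ε}, ?_, fun z hz => hz⟩
    have := hp.tendsto 0
    rw [map_zero] at this
    exact this.eventually (gt_mem_nhds hε)
  obtain ⟨δ, hδ, h⟩ := Metric.mem_uniformity_dist.1 (mem_inf_principal.1 (hu hent))
  obtain ⟨N₀, hN₀⟩ := exists_nat_one_div_lt (lt_min hδ one_pos)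
  refine ⟨N₀, fun N hN x hx => ?_⟩
  have h1 := (dist_gridPoint_le N x).trans_lt ((Nat.one_div_le_one_div hN).trans_lt hN₀)
  refine (h (a := x) (b := gridPoint N (gridIndex N x)) ?_ ⟨?_, ?_⟩).le
  · rw [dist_comm]
    exact h1.trans_le (min_le_left _ _)
  · exact Metric.self_subset_cthickening _ hx
  · exact Metric.mem_cthickening_of_dist_le _ x _ _ hx (h1.trans_le (min_le_right _ _)).le

theorem integrableOn_dual_comp {f : (Fin d → ℝ) → E} (hf : Continuous f) (e' : E →L[ℂ] ℂ) :
    IntegrableOn (fun x => e' (f x)) (cube d) volume :=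
  (e'.continuous.comp hf).continuousOn.integrableOn_compact (isCompact_cube d)

theorem map_riemannSum (f : (Fin d → ℝ) → E) (e' : E →L[ℂ] ℂ) (N : ℕ) :
    e' (riemannSum f N) = riemannSum (fun x => e' (f x)) N := by
  simp only [riemannSum, map_sum, map_smul]

theorem norm_riemannSum_sub_integral_le {f : (Fin d → ℝ) → E} (hf : Continuous f)
    (e' : E →L[ℂ] ℂ) {N : ℕ} {ε : ℝ}
    (h : ∀ x ∈ cube d, ‖e' (f (gridPoint N (gridIndex N x)) - f x)‖ ≤ ε) :
    ‖e' (riemannSum f N) - ∫ x in cube d, e' (f x)‖ ≤ ε * volume.real (cube d) := by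
  obtain ⟨h1, h2⟩ := riemannSum_eq_integral (fun x => e' (f x)) N
  rw [map_riemannSum, h2, ← integral_sub h1 (integrableOn_dual_comp hf e')]
  refine norm_setIntegral_le_of_norm_le_const (isCompact_cube d).measure_lt_top fun x hx => ?_
  rw [← map_sub]
  exact h x hx

/-- The index `N₀` is the same for all functionals dominated by `p`; this uniformity turns weak
convergence into the Cauchy property for `p`. -/
theorem exists_forall_riemannSum_le {f : (Fin d → ℝ) → E} (hf : Continuous f)
    {p : Seminorm ℂ E} (hp : Continuous p) {ε : ℝ} (hε : 0 < ε) :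
    ∃ N₀, ∀ N ≥ N₀, ∀ e' : E →L[ℂ] ℂ, (∀ v, ‖e' v‖ ≤ p v) →
      ‖e' (riemannSum f N) - ∫ x in cube d, e' (f x)‖ < ε := by
  have hv : 0 < volume.real (cube d) + 1 := by positivity
  obtain ⟨N₀, hN₀⟩ := exists_forall_seminorm_gridPoint_sub_le hf hp (div_pos hε hv)
  refine ⟨N₀, fun N hN e' he' => ?_⟩
  refine (norm_riemannSum_sub_integral_le hf e' fun x hx => (he' _).trans (hN₀ N hN x hx)).trans_lt
    ?_
  rw [div_mul_eq_mul_div, div_lt_iff₀ hv]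
  exact mul_lt_mul_of_pos_left (lt_add_one _) hε

/-- Continuous functions with values in a sequentially complete space are Pettis integrable. -/
theorem exists_hasPettisIntegral (hE : IsSequentiallyComplete E) {f : (Fin d → ℝ) → E}
    (hf : Continuous f) : ∃ e, HasPettisIntegral volume (cube d) f e := by
  have hc : CauchySeq (riemannSum f) := by
    refine cauchySeq_of_seminorm fun p hp ε hε => ?_
    obtain ⟨N₀, hN₀⟩ := exists_forall_riemannSum_le hf hp (div_pos hε three_pos)
    refine ⟨N₀, fun N hN => lt_of_le_of_lt (b := ε / 3 + ε / 3) ?_ (by linarith)⟩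
    refine seminorm_le_of_forall_dual hp fun e' he' => ?_
    rw [map_sub, ← sub_sub_sub_cancel_right _ _ (∫ x in cube d, e' (f x))]
    exact (norm_sub_le _ _).trans
      (add_le_add (hN₀ N hN e' he').le (hN₀ N₀ le_rfl e' he').le)
  obtain ⟨e, he⟩ := hE _ hc
  refine ⟨e, fun e' => ⟨integrableOn_dual_comp hf e', ?_⟩⟩
  refine tendsto_nhds_unique ((e'.continuous.tendsto e).comp he) (Metric.tendsto_atTop.2 ?_)
  intro ε hε
  -- The modulus of `e'` is itself a continuous seminorm dominating `e'`, so the uniform estimate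
  -- identifies the limit.
  obtain ⟨N₀, hN₀⟩ := exists_forall_riemannSum_le hf (continuous_dual_norm e') hε
  exact ⟨N₀, fun N hN => by
    rw [dist_eq_norm]
    exact hN₀ N hN e' fun v => le_rfl⟩

theorem hasPettisIntegral_pettisIntegral (hE : IsSequentiallyComplete E) {f : (Fin d → ℝ) → E}
    (hf : Continuous f) :
    HasPettisIntegral volume (cube d) f (pettisIntegral volume (cube d) f) := by
  have h : PettisIntegrable volume (cube d) f := exists_hasPettisIntegral hE hf
  rw [pettisIntegral, dif_pos h]
  exact h.choose_spec

end Pettis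

/-! ### Scalar Fourier coefficients -/

section ScalarCoefficients

variable {d : ℕ}

theorem HasPartialDerivAt.hasDerivAt {g : (Fin d → ℝ) → ℂ} {i : Fin d} {a : ℂ} {x : Fin d → ℝ}
    (h : HasPartialDerivAt g i a x) : HasDerivAt (fun t : ℝ => g (x + Pi.single i t)) a 0 := by
  rw [hasDerivAt_iff_tendsto_slope_zero]
  refine h.congr fun t => ?_
  rw [zero_add, Pi.single_zero, add_zero, ← Complex.ofReal_inv, Complex.real_smul, smul_eq_mul]

theorem HasPartialDerivAt.hasDerivAt_insertNth {m : ℕ} {g : (Fin (m + 1) → ℝ) → ℂ}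
    {i : Fin (m + 1)} {a : ℂ} {t : ℝ} {y : Fin m → ℝ}
    (h : HasPartialDerivAt g i a (i.insertNth t y)) :
    HasDerivAt (fun s : ℝ => g (i.insertNth s y : Fin (m + 1) → ℝ)) a t := by
  have h1 := h.hasDerivAt
  rw [← sub_self t] at h1
  refine (h1.comp_sub_const t t).congr_of_eventuallyEq (Eventually.of_forall fun s => ?_)
  simp only
  congr 1
  -- Changing the inserted coordinate from `t` to `s` amounts to adding `s - t` along the `i`-th
  -- axis.
  rw [← Fin.insertNth_zero_right, ← Fin.insertNth_add, add_sub_cancel, add_zero]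

/-- The integral of a partial derivative of a periodic function over a period cube vanishes. -/
theorem integral_partialDeriv_eq_zero {g g' : (Fin d → ℝ) → ℂ} {i : Fin d}
    (hg' : Continuous g') (h : ∀ x, HasPartialDerivAt g i (g' x) x)
    (hper : ∀ x, g (x + Pi.single i (2 * Real.pi)) = g x) : ∫ x in cube d, g' x = 0 := by
  obtain _ | m := d
  · exact i.elim0
  let e : ℝ × (Fin m → ℝ) ≃ᵐ (Fin (m + 1) → ℝ) :=
    (MeasurableEquiv.piFinSuccAbove (fun _ => ℝ) i).symm
  have hem : MeasurePreserving e :=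
    (volume_preserving_piFinSuccAbove (fun _ : Fin (m + 1) => ℝ) i).symm _
  have he : ∀ z, e z = i.insertNth z.1 z.2 := fun _ => rfl
  have hpre : e ⁻¹' cube (m + 1) = Set.Icc (-Real.pi) Real.pi ×ˢ cube m :=
    ((Fin.insertNthOrderIso (fun _ => ℝ) i).preimage_Icc _ _).trans (Set.Icc_prod_eq _ _)
  have hcont : Continuous fun z : (Fin m → ℝ) × ℝ =>
      g' (i.insertNth z.2 z.1 : Fin (m + 1) → ℝ) :=
    hg'.comp (Continuous.finInsertNth i continuous_snd continuous_fst)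
  -- Fubini with the `i`-th coordinate innermost: the inner integral is a difference of values of
  -- `g` at `π` and `-π`, which agree by periodicity.
  rw [← hem.map_eq, setIntegral_map_equiv, hpre, Measure.volume_eq_prod, ← setIntegral_prod_swap,
    setIntegral_prod]
  · refine setIntegral_eq_zero_of_forall_eq_zero fun y _ => ?_
    have hle : -Real.pi ≤ Real.pi := by linarith [Real.pi_pos]
    have hc : Continuous fun t : ℝ => g' (i.insertNth t y : Fin (m + 1) → ℝ) :=
      hcont.comp (Continuous.prodMk continuous_const continuous_id)
    simp only [Prod.swap_prod_mk, he]
    rw [integral_Icc_eq_integral_Ioc, ← intervalIntegral.integral_of_le hle,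
      intervalIntegral.integral_eq_sub_of_hasDerivAt
        (fun t _ => (h (i.insertNth t y)).hasDerivAt_insertNth) (hc.intervalIntegrable _ _),
      sub_eq_zero, ← hper (i.insertNth (-Real.pi) y)]
    congr 1
    rw [← Fin.insertNth_zero_right, ← Fin.insertNth_add, add_zero]
    congr 1
    ring
  · refine Continuous.continuousOn (hcont.congr fun z => rfl) |>.integrableOn_compact
      ((isCompact_cube m).prod isCompact_Icc)

theorem hasPartialDerivAt_character (k : Fin d → ℤ) (i : Fin d) (t : Fin d → ℝ) :
    HasPartialDerivAt (character k) i (character k t * (Complex.I * (k i : ℂ))) t := by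
  refine tendsto_iff_norm_sub_tendsto_zero.2 ?_
  have h1 : Tendsto (fun h : ℝ => |h| * (2 * weight 2 k)) (𝓝[≠] 0) (𝓝 0) := by
    have h2 : Tendsto (fun h : ℝ => |h| * (2 * weight 2 k)) (𝓝 0) (𝓝 (|0| * (2 * weight 2 k))) :=
      (continuous_abs.tendsto 0).mul_const _
    rw [abs_zero, zero_mul] at h2
    exact h2.mono_left nhdsWithin_le_nhds
  refine squeeze_zero' (Eventually.of_forall fun _ => norm_nonneg _) ?_ h1
  filter_upwards [self_mem_nhdsWithin] with h hh
  exact norm_differenceQuotient_character_le k t i hh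

theorem HasPartialDerivAt.mul {f g : (Fin d → ℝ) → ℂ} {i : Fin d} {a b : ℂ} {x : Fin d → ℝ}
    (hf : HasPartialDerivAt f i a x) (hg : HasPartialDerivAt g i b x) :
    HasPartialDerivAt (fun y => f y * g y) i (a * g x + f x * b) x := by
  have h := hf.hasDerivAt.mul hg.hasDerivAt
  simp only [Pi.single_zero, add_zero] at h
  rw [hasDerivAt_iff_tendsto_slope_zero] at h
  refine h.congr fun t => ?_
  simp only [Pi.mul_apply]
  rw [zero_add, Pi.single_zero, add_zero, ← Complex.ofReal_inv, Complex.real_smul, smul_eq_mul]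

/-- The `n`-th Fourier coefficient of a scalar function. -/
def scalarCoeff (g : (Fin d → ℝ) → ℂ) (n : Fin d → ℤ) : ℂ :=
  ((2 * (Real.pi : ℂ)) ^ d)⁻¹ * ∫ x in cube d, character (-n) x * g x

theorem integrableOn_character_mul {g : (Fin d → ℝ) → ℂ} (hg : Continuous g) (n : Fin d → ℤ) :
    IntegrableOn (fun x => character n x * g x) (cube d) volume :=
  ((continuous_character n).mul hg).continuousOn.integrableOn_compact (isCompact_cube d)

/-- Integration by parts without boundary terms: the derivative of the periodic product of
`character (-n)` and `g` integrates to zero. -/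
theorem scalarCoeff_partialDeriv {g g' : (Fin d → ℝ) → ℂ} {i : Fin d} (hg : Continuous g)
    (hg' : Continuous g') (h : ∀ x, HasPartialDerivAt g i (g' x) x)
    (hper : ∀ x, g (x + Pi.single i (2 * Real.pi)) = g x) (n : Fin d → ℤ) :
    scalarCoeff g' n = Complex.I * (n i : ℂ) * scalarCoeff g n := by
  have h0 := integral_partialDeriv_eq_zero (i := i)
    (g := fun x => character (-n) x * g x)
    (g' := fun x => character (-n) x * (Complex.I * ((-n) i : ℤ)) * g x +
      character (-n) x * g' x)
    ((((continuous_character _).mul continuous_const).mul hg).add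
      ((continuous_character _).mul hg'))
    (fun x => (hasPartialDerivAt_character (-n) i x).mul (h x))
    (fun x => by rw [character_periodic, hper])
  have h1 : ∀ x, character (-n) x * (Complex.I * ((-n) i : ℤ)) * g x =
      -(Complex.I * (n i : ℂ)) * (character (-n) x * g x) := fun x => by
    push_cast [Pi.neg_apply]
    ring
  simp only [h1] at h0
  rw [integral_add ((integrableOn_character_mul hg _).const_mul _)
    (integrableOn_character_mul hg' _), integral_const_mul] at h0
  rw [scalarCoeff, scalarCoeff, eq_neg_of_add_eq_zero_right h0]
  ring

theorem volume_real_cube (d : ℕ) : volume.real (cube d) = (2 * Real.pi) ^ d := by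
  rw [Measure.real, cube, Real.volume_Icc_pi_toReal (fun _ => by linarith [Real.pi_pos])]
  rw [Finset.prod_const, Finset.card_fin]
  congr 1
  ring

theorem two_pi_pow_ne_zero (d : ℕ) : ((2 * (Real.pi : ℂ)) ^ d) ≠ 0 :=
  pow_ne_zero _ (mul_ne_zero two_ne_zero (Complex.ofReal_ne_zero.2 Real.pi_ne_zero))

/-- Characters have modulus one, and the normalizing factor cancels the volume of the cube. -/
theorem norm_scalarCoeff_le {g : (Fin d → ℝ) → ℂ} {C : ℝ} (h : ∀ x ∈ cube d, ‖g x‖ ≤ C)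
    (n : Fin d → ℤ) : ‖scalarCoeff g n‖ ≤ C := by
  have hpos : (0 : ℝ) < (2 * Real.pi) ^ d := by positivity
  have h1 : ‖∫ x in cube d, character (-n) x * g x‖ ≤ C * volume.real (cube d) :=
    norm_setIntegral_le_of_norm_le_const (isCompact_cube d).measure_lt_top fun x hx => by
      rw [norm_mul, norm_character, one_mul]
      exact h x hx
  rw [volume_real_cube] at h1
  have h2 : ‖((2 * (Real.pi : ℂ)) ^ d)⁻¹‖ = ((2 * Real.pi) ^ d)⁻¹ := by
    rw [norm_inv, norm_pow, norm_mul, Complex.norm_real, Real.norm_of_nonneg Real.pi_pos.le]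
    norm_num
  rw [scalarCoeff, norm_mul, h2, inv_mul_le_iff₀ hpos, mul_comm]
  exact h1

/-- If `n_i ≠ 0`, then `i n_i` times the character is a partial derivative of a periodic function,
so its integral vanishes. -/
theorem integral_character (n : Fin d → ℤ) :
    ∫ x in cube d, character n x = if n = 0 then (2 * (Real.pi : ℂ)) ^ d else 0 := by
  split_ifs with hn
  · subst hn
    have h1 : ∀ x : Fin d → ℝ, character 0 x = 1 := fun x => by simp [character]
    simp only [h1]
    rw [setIntegral_const, volume_real_cube, Complex.real_smul, mul_one]
    push_cast
    ring
  · obtain ⟨i, hi⟩ := Function.ne_iff.1 hn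
    have h := integral_partialDeriv_eq_zero (i := i) (g := character n)
      ((continuous_character n).mul continuous_const)
      (fun x => hasPartialDerivAt_character n i x) (fun x => character_periodic n x i)
    simp only [Pi.mul_apply] at h
    rw [integral_mul_const] at h
    refine (mul_eq_zero.1 h).resolve_right (mul_ne_zero Complex.I_ne_zero ?_)
    exact_mod_cast hi

theorem character_mul (m n : Fin d → ℤ) (x : Fin d → ℝ) :
    character m x * character n x = character (m + n) x := by
  simp only [character, ← Complex.exp_add, Pi.add_apply]
  congr 1
  rw [← mul_add, ← Complex.ofReal_add, ← Finset.sum_add_distrib]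
  congr 2
  refine Finset.sum_congr rfl fun i _ => ?_
  push_cast
  ring

/-- Absolute summability permits termwise integration, and orthogonality of the characters leaves
only the `n`-th term. -/
theorem scalarCoeff_series {c : (Fin d → ℤ) → ℂ} (hc : Summable fun k => ‖c k‖)
    (n : Fin d → ℤ) : scalarCoeff (fun t => ∑' k, character k t * c k) n = c n := by
  have h1 : ∫ x in cube d, character (-n) x * ∑' k, character k x * c k =
      ∑' k, ∫ x in cube d, character (-n) x * (character k x * c k) := by
    simp only [← tsum_mul_left]
    rw [integral_tsum_of_summable_integral_norm]
    · exact fun k => integrableOn_character_mul ((continuous_character k).mul continuous_const) _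
    · simp only [norm_mul, norm_character, one_mul, integral_const]
      exact hc.mul_left _
  have h2 : ∀ k, ∫ x in cube d, character (-n) x * (character k x * c k) =
      if k = n then (2 * (Real.pi : ℂ)) ^ d * c n else 0 := fun k => by
    simp only [← mul_assoc, character_mul]
    rw [integral_mul_const, integral_character]
    by_cases hk : k = n
    · rw [if_pos hk, if_pos (by rw [hk, neg_add_cancel]), hk]
    · rw [if_neg hk, if_neg (fun h => hk (neg_add_eq_zero.1 h).symm), zero_mul]
  rw [scalarCoeff, h1]
  simp only [h2]
  rw [tsum_ite_eq, ← mul_assoc, inv_mul_cancel₀ (two_pi_pow_ne_zero d), one_mul]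

end ScalarCoefficients

/-! ### Fourier inversion for scalar functions -/

section Inversion

open scoped Pointwise

variable {d : ℕ}

/-- The covering `x ↦ x mod 1` of the torus. -/
def torusMk (x : Fin d → ℝ) : UnitAddTorus (Fin d) := fun i => (x i : UnitAddCircle)

theorem isOpenQuotientMap_torusMk : IsOpenQuotientMap (torusMk (d := d)) :=
  IsOpenQuotientMap.piMap fun _ => QuotientAddGroup.isOpenQuotientMap_mk

/-- Points with the same class differ by an integer vector; scaled by `2π`, it is an integer
combination of the coordinate periods. -/
theorem periodic_two_pi_smul {g : (Fin d → ℝ) → ℂ}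
    (hper : ∀ i x, g (x + Pi.single i (2 * Real.pi)) = g x) {x y : Fin d → ℝ}
    (h : torusMk x = torusMk y) : g ((2 * Real.pi) • x) = g ((2 * Real.pi) • y) := by
  have h1 : ∀ i, ∃ m : ℤ, y i = x i + m := fun i => by
    have h2 := congrFun h i
    obtain ⟨m, hm⟩ := (QuotientAddGroup.eq_iff_sub_mem.1 h2.symm)
    refine ⟨m, ?_⟩
    simp only [zsmul_eq_mul, mul_one] at hm
    linarith
  choose m hm using h1
  have h2 : (2 * Real.pi) • y = (2 * Real.pi) • x +
      ∑ i, m i • (Pi.single i (2 * Real.pi) : Fin d → ℝ) := by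
    funext j
    simp only [Pi.smul_apply, Pi.add_apply, Finset.sum_apply, smul_eq_mul, hm j]
    rw [Finset.sum_eq_single j]
    · rw [Pi.single_eq_same, zsmul_eq_mul]
      ring
    · intro i _ hi
      rw [Pi.single_eq_of_ne hi.symm, smul_zero]
    · simp
  have h3 : ∀ s : Finset (Fin d), Function.Periodic g
      (∑ i ∈ s, m i • (Pi.single i (2 * Real.pi) : Fin d → ℝ)) := by
    classical
    intro s
    induction s using Finset.induction_on with
    | empty => exact fun x => by simp
    | insert i s hi ih =>
      rw [Finset.sum_insert hi]
      exact Function.Periodic.add_period (Function.Periodic.zsmul (fun x => hper i x) (m i)) ih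
  rw [h2, h3]

theorem exists_torus_lift {g : (Fin d → ℝ) → ℂ} (hg : Continuous g)
    (hper : ∀ i x, g (x + Pi.single i (2 * Real.pi)) = g x) :
    ∃ G : C(UnitAddTorus (Fin d), ℂ), ∀ x, G (torusMk x) = g ((2 * Real.pi) • x) := by
  have hq := isOpenQuotientMap_torusMk (d := d)
  have h : ∀ x, g ((2 * Real.pi) • Function.surjInv hq.surjective (torusMk x)) =
      g ((2 * Real.pi) • x) := fun x =>
    periodic_two_pi_smul hper (Function.surjInv_eq hq.surjective _)
  refine ⟨⟨fun y => g ((2 * Real.pi) • Function.surjInv hq.surjective y), ?_⟩, h⟩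
  rw [hq.isQuotientMap.continuous_iff]
  exact (hg.comp (continuous_const_smul _)).congr fun x => (h x).symm

theorem mFourier_torusMk (n : Fin d → ℤ) (x : Fin d → ℝ) :
    UnitAddTorus.mFourier n (torusMk x) = character n ((2 * Real.pi) • x) := by
  have h1 : UnitAddTorus.mFourier n (torusMk x) = ∏ i, fourier (n i) (x i : UnitAddCircle) := rfl
  rw [h1]
  simp only [fourier_coe_apply]
  rw [← Complex.exp_sum, character]
  congr 1
  push_cast
  rw [Finset.mul_sum]
  refine Finset.sum_congr rfl fun i _ => ?_
  simp
  ring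

/-- Substitution `y = 2πx`: the Jacobian supplies `(2π)^{-d}`, and the fundamental domain based at
`-1/2` becomes `(-π, π]^d`, which is the closed cube up to a null set. -/
theorem mFourierCoeff_lift {g : (Fin d → ℝ) → ℂ} {G : C(UnitAddTorus (Fin d), ℂ)}
    (hG : ∀ x, G (torusMk x) = g ((2 * Real.pi) • x)) (n : Fin d → ℤ) :
    UnitAddTorus.mFourierCoeff G n = scalarCoeff g n := by
  have hpi : (0 : ℝ) < 2 * Real.pi := by positivity
  rw [UnitAddTorus.mFourierCoeff_eq_integral G n (fun _ => -(1 / 2))]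
  have h1 : ∀ x : Fin d → ℝ, UnitAddTorus.mFourier (-n) (fun i => (x i : UnitAddCircle)) •
      G (fun i => (x i : UnitAddCircle)) =
      (fun y => character (-n) y * g y) ((2 * Real.pi) • x) := fun x => by
    rw [smul_eq_mul]
    exact congrArg₂ (· * ·) (mFourier_torusMk (-n) x) (hG x)
  simp only [h1]
  rw [Measure.setIntegral_comp_smul_of_pos volume (fun y => character (-n) y * g y) _ hpi,
    scalarCoeff, Complex.real_smul, Module.finrank_fin_fun]
  have h2 : (2 * Real.pi) • {x : Fin d → ℝ | ∀ i, x i ∈ Set.Ioc (-(1 / 2)) (-(1 / 2) + 1)} =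
      Set.univ.pi fun _ => Set.Ioc (-Real.pi) Real.pi := by
    ext y
    rw [Set.mem_smul_set_iff_inv_smul_mem₀ hpi.ne']
    simp only [Set.mem_ofPred_eq, Set.mem_pi, Set.mem_univ, true_imp_iff, Pi.smul_apply,
      smul_eq_mul, Set.mem_Ioc]
    refine forall_congr' fun i => ?_
    rw [lt_inv_mul_iff₀ hpi, inv_mul_le_iff₀ hpi]
    constructor <;> rintro ⟨h, h'⟩ <;> constructor <;> linarith
  rw [h2, setIntegral_congr_set (t := cube d)]
  · push_cast
    rfl
  · exact Measure.univ_pi_Ioc_ae_eq_Icc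

/-- Pointwise Fourier inversion for scalar functions with summable Fourier coefficients. -/
theorem hasSum_scalarCoeff {g : (Fin d → ℝ) → ℂ} (hg : Continuous g)
    (hper : ∀ i x, g (x + Pi.single i (2 * Real.pi)) = g x) (hs : Summable (scalarCoeff g))
    (t : Fin d → ℝ) : HasSum (fun k => character k t * scalarCoeff g k) (g t) := by
  obtain ⟨G, hG⟩ := exists_torus_lift hg hper
  have h1 : UnitAddTorus.mFourierCoeff G = scalarCoeff g := funext fun n => mFourierCoeff_lift hG n
  have h2 := UnitAddTorus.hasSum_mFourier_series_apply_of_summable (f := G) (by rwa [h1])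
    (torusMk ((2 * Real.pi)⁻¹ • t))
  have h3 : (2 * Real.pi) • (2 * Real.pi)⁻¹ • t = t := smul_inv_smul₀ (by positivity) t
  rw [hG, h3, h1] at h2
  simp only [mFourier_torusMk, h3, smul_eq_mul] at h2
  simpa only [mul_comm] using h2

end Inversion

/-! ### The Fourier coefficient map -/

section FourierMap

variable {d : ℕ} {E : Type*} [AddCommGroup E] [Module ℂ E]

section Top

variable [TopologicalSpace E]

theorem HasPartialDerivAt.dual {f : (Fin d → ℝ) → E} {i : Fin d} {a : E} {x : Fin d → ℝ}
    (h : HasPartialDerivAt f i a x) (e' : E →L[ℂ] ℂ) :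
    HasPartialDerivAt (fun y => e' (f y)) i (e' a) x := by
  refine ((e'.continuous.tendsto a).comp h).congr fun t => ?_
  simp only [Function.comp_apply, map_smul, map_sub]

variable [T2Space E]

theorem partialDeriv_periodic {f : (Fin d → ℝ) → E} (hf : IsSmooth f)
    (hper : ∀ (i : Fin d) x, f (x + Pi.single i (2 * Real.pi)) = f x) (j i : Fin d)
    (x : Fin d → ℝ) :
    partialDeriv j f (x + Pi.single i (2 * Real.pi)) = partialDeriv j f x := by
  refine HasPartialDerivAt.partialDeriv_eq ((hf.hasPartialDerivAt j x).congr fun h => ?_)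
  rw [hper, add_right_comm, hper]

theorem scalarCoeff_iterate_partialDeriv {f : (Fin d → ℝ) → E} (hf : IsSmooth f)
    (hper : ∀ (i : Fin d) x, f (x + Pi.single i (2 * Real.pi)) = f x) (e' : E →L[ℂ] ℂ)
    (i : Fin d) (m : ℕ) (n : Fin d → ℤ) :
    scalarCoeff (fun x => e' ((partialDeriv i)^[m] f x)) n =
      (Complex.I * (n i : ℂ)) ^ m * scalarCoeff (fun x => e' (f x)) n := by
  induction m generalizing f with
  | zero => rw [pow_zero, one_mul]; rfl
  | succ m ih =>
    have h := scalarCoeff_partialDeriv (i := i) (g := fun x => e' (f x))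
      (g' := fun x => e' (partialDeriv i f x)) (e'.continuous.comp hf.continuous)
      (e'.continuous.comp (hf.partialDeriv i).continuous)
      (fun x => (hf.hasPartialDerivAt i x).dual e') (fun x => by rw [hper]) n
    simp only [Function.iterate_succ_apply]
    rw [ih (hf.partialDeriv i) (partialDeriv_periodic hf hper i), h, pow_succ, mul_assoc, mul_assoc, mul_assoc]

/-- Connects the pure derivatives, the only ones used for the decay of coefficients, with the
seminorms, which range over multi-indices. -/
theorem multiDeriv_single (i : Fin d) (m : ℕ) (f : (Fin d → ℝ) → E) :
    multiDeriv (Pi.single i m) f = (partialDeriv i)^[m] f := by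
  have h1 : ∀ l : List (Fin d), i ∉ l →
      l.foldr (fun j g => (partialDeriv j)^[(Pi.single i m : Fin d → ℕ) j] g) f = f := by
    intro l hl
    induction l with
    | nil => rfl
    | cons j l ih =>
      rw [List.mem_cons, not_or] at hl
      rw [List.foldr_cons, ih hl.2, Pi.single_eq_of_ne (Ne.symm hl.1), Function.iterate_zero, id]
  have h2 : ∀ l : List (Fin d), l.Nodup → i ∈ l →
      l.foldr (fun j g => (partialDeriv j)^[(Pi.single i m : Fin d → ℕ) j] g) f =
        (partialDeriv i)^[m] f := by
    intro l hl hi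
    induction l with
    | nil => exact absurd hi List.not_mem_nil
    | cons j l ih =>
      rw [List.nodup_cons] at hl
      rw [List.foldr_cons]
      by_cases hj : i = j
      · subst hj
        rw [h1 l hl.1, Pi.single_eq_same]
      · rw [ih hl.2 ((List.mem_cons.1 hi).resolve_left hj), Pi.single_eq_of_ne (Ne.symm hj),
          Function.iterate_zero, id]
  exact h2 _ (List.nodup_finRange d) (List.mem_finRange i)

variable [IsTopologicalAddGroup E] [ContinuousConstSMul ℂ E]

theorem SmoothPeriodic.periodic (f : SmoothPeriodic d E) (i : Fin d) (x : Fin d → ℝ) :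
    f.1 (x + Pi.single i (2 * Real.pi)) = f.1 x := f.2 i x

/-- The cube as a compact set. -/
def cubeCompacts (d : ℕ) : TopologicalSpace.Compacts (Fin d → ℝ) := ⟨cube d, isCompact_cube d⟩

theorem Smooth.iterate_partialDeriv_le (f : Smooth d E) {p : Seminorm ℂ E} (hp : Continuous p)
    (i : Fin d) {m l : ℕ} (h : m ≤ l) {x : Fin d → ℝ} (hx : x ∈ cube d) :
    p ((partialDeriv i)^[m] f x) ≤ Smooth.seminorm (cubeCompacts d) l ⟨p, hp⟩ f := by
  have h1 := le_ciSup (f.bddAbove (cubeCompacts d) l ⟨p, hp⟩)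
    (⟨x, hx⟩, ⟨Pi.single i m, by simpa using h⟩)
  simp only [multiDeriv_single] at h1
  exact h1

theorem Smooth.le_seminorm_cube (f : Smooth d E) {p : Seminorm ℂ E} (hp : Continuous p)
    (l : ℕ) {x : Fin d → ℝ} (hx : x ∈ cube d) :
    p (f x) ≤ Smooth.seminorm (cubeCompacts d) l ⟨p, hp⟩ f := by
  have h1 := le_ciSup (f.bddAbove (cubeCompacts d) l ⟨p, hp⟩) (⟨x, hx⟩, ⟨0, by simp⟩)
  have h2 : multiDeriv (0 : Fin d → ℕ) (f : (Fin d → ℝ) → E) = f := by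
    unfold multiDeriv
    induction List.finRange d with
    | nil => rfl
    | cons i l ih => simp
  simp only [h2] at h1
  exact h1

end Top

variable [UniformSpace E] [IsUniformAddGroup E] [ContinuousSMul ℂ E] [T2Space E]
  [PolynormableSpace ℂ E]

theorem fourierIntegrand_eq (f : SmoothPeriodic d E) (n : Fin d → ℤ) :
    fourierIntegrand f n = fun x => character (-n) x • f.1 x :=
  funext fun x => by rw [fourierIntegrand, character_neg]

theorem continuous_fourierIntegrand (f : SmoothPeriodic d E) (n : Fin d → ℤ) :
    Continuous (fourierIntegrand f n) := by
  rw [fourierIntegrand_eq]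
  exact (continuous_character _).smul f.1.isSmooth.continuous

/-- The defining property of the Pettis integral; through it every statement on vector coefficients
becomes one on scalar coefficients. -/
theorem dual_fourierCoeff (hE : IsSequentiallyComplete E) (f : SmoothPeriodic d E)
    (n : Fin d → ℤ) (e' : E →L[ℂ] ℂ) :
    e' (fourierCoeff f n) = scalarCoeff (fun x => e' (f.1 x)) n := by
  have h := (hasPettisIntegral_pettisIntegral hE (continuous_fourierIntegrand f n) e').2
  rw [fourierCoeff, map_smul, h, scalarCoeff, smul_eq_mul, fourierIntegrand_eq]
  simp only [map_smul, smul_eq_mul]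

/-- For each functional dominated by `p`, the scalar coefficient and its products with `|n_i|^(2j)`
are bounded by the same seminorm of `f`, via `2j` integrations by parts in one variable. These `d +
1` bounds account for the extra factor `d + 1`. -/
theorem seminorm_fourierCoeff_mul_weight_le (hE : IsSequentiallyComplete E)
    (f : SmoothPeriodic d E) (j : ℕ) {p : Seminorm ℂ E} (hp : Continuous p) (n : Fin d → ℤ) :
    p (fourierCoeff f n) * weight j n ≤
      ((d : ℝ) + 1) ^ (j + 1) * Smooth.seminorm (cubeCompacts d) (2 * j) ⟨p, hp⟩ f.1 := by
  rw [← le_div_iff₀ (weight_pos _ _)]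
  refine seminorm_le_of_forall_dual hp fun e' he' => ?_
  rw [le_div_iff₀ (weight_pos _ _), dual_fourierCoeff hE]
  set S := Smooth.seminorm (cubeCompacts d) (2 * j) ⟨p, hp⟩ f.1
  set c := scalarCoeff (fun x => e' (f.1 x)) n
  have h0 : ‖c‖ ≤ S :=
    norm_scalarCoeff_le (fun x hx => (he' _).trans (f.1.le_seminorm_cube hp _ hx)) n
  have h1 : ∀ i, ‖c‖ * |(n i : ℝ)| ^ (2 * j) ≤ S := fun i => by
    have h2 := scalarCoeff_iterate_partialDeriv f.1.isSmooth f.2 e' i (2 * j) n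
    have h3 := norm_scalarCoeff_le (fun x hx =>
      (he' _).trans (f.1.iterate_partialDeriv_le hp i (le_refl (2 * j)) hx)) n
    rw [h2, norm_mul, norm_pow, norm_mul, Complex.norm_I, one_mul, Complex.norm_intCast,
      mul_comm] at h3
    exact h3
  calc ‖c‖ * weight j n
      ≤ ‖c‖ * (((d : ℝ) + 1) ^ j * (1 + ∑ i, |(n i : ℝ)| ^ (2 * j))) :=
        mul_le_mul_of_nonneg_left (weight_le_sum_pow j n) (norm_nonneg _)
    _ = ((d : ℝ) + 1) ^ j * (‖c‖ + ∑ i, ‖c‖ * |(n i : ℝ)| ^ (2 * j)) := by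
        rw [← Finset.mul_sum]
        ring
    _ ≤ ((d : ℝ) + 1) ^ j * (S + ∑ _i : Fin d, S) := by
        refine mul_le_mul_of_nonneg_left ?_ (by positivity)
        exact add_le_add h0 (Finset.sum_le_sum fun i _ => h1 i)
    _ = ((d : ℝ) + 1) ^ (j + 1) * S := by
        rw [Finset.sum_const, Finset.card_fin, nsmul_eq_mul]
        ring

/-- The family of the Fourier coefficients. -/
def fourierRapid (hE : IsSequentiallyComplete E) (f : SmoothPeriodic d E) : Rapid d E :=
  Rapid.mk (fourierCoeff f) fun j _ hp => ⟨_, seminorm_fourierCoeff_mul_weight_le hE f j hp⟩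

theorem fourierRapid_toSmoothPeriodic (hE : IsSequentiallyComplete E) (x : Rapid d E) :
    fourierRapid hE (x.toSmoothPeriodic hE) = x := by
  refine Rapid.ext fun n => eq_of_forall_dual fun e' => ?_
  rw [fourierRapid, Rapid.mk_apply, dual_fourierCoeff hE]
  have h1 : ∀ t, e' ((x.toSmoothPeriodic hE).1 t) = ∑' k, character k t * e' (x k) := fun t => by
    have h2 := (x.hasSum_series hE t).mapL e'
    simp only [map_smul, smul_eq_mul] at h2
    exact h2.tsum_eq.symm
  simp only [h1]
  exact scalarCoeff_series (x.summable_seminorm (continuous_dual_norm e')) n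

/-- After applying a functional, this is scalar inversion; its summability hypothesis is the decay
of the vector coefficients just established. -/
theorem toSmoothPeriodic_fourierRapid (hE : IsSequentiallyComplete E) (f : SmoothPeriodic d E) :
    (fourierRapid hE f).toSmoothPeriodic hE = f := by
  refine Subtype.ext (DFunLike.ext _ _ fun t => eq_of_forall_dual fun e' => ?_)
  have h2 := ((fourierRapid hE f).hasSum_series hE t).mapL e'
  have h3 : ∀ k, e' (fourierRapid hE f k) = scalarCoeff (fun x => e' (f.1 x)) k := fun k =>
    dual_fourierCoeff hE f k e'
  simp only [map_smul, smul_eq_mul, h3] at h2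
  refine h2.unique (hasSum_scalarCoeff (e'.continuous.comp f.1.isSmooth.continuous)
    (fun i x => congrArg e' (f.periodic i x)) ?_ t)
  have h4 := (fourierRapid hE f).summable_seminorm (continuous_dual_norm e')
  have h5 : ∀ k, e'.toSeminorm (fourierRapid hE f k) =
      ‖scalarCoeff (fun x => e' (f.1 x)) k‖ := fun k => by
    rw [← h3]
    rfl
  simp only [h5] at h4
  exact h4.of_norm

/-- Trigonometric series as a linear bijection from coefficients to functions. -/
def seriesLinearEquiv (hE : IsSequentiallyComplete E) : Rapid d E ≃ₗ[ℂ] SmoothPeriodic d E where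
  toFun x := x.toSmoothPeriodic hE
  map_add' x y := by
    refine Subtype.ext (DFunLike.ext _ _ fun t => ?_)
    have h := (x.hasSum_series hE t).add (y.hasSum_series hE t)
    simp only [← smul_add] at h
    exact ((x + y).hasSum_series hE t).unique h
  map_smul' c x := by
    refine Subtype.ext (DFunLike.ext _ _ fun t => ?_)
    have h := (x.hasSum_series hE t).const_smul c
    simp only [smul_comm c] at h
    exact ((c • x).hasSum_series hE t).unique h
  invFun := fourierRapid hE
  left_inv := fourierRapid_toSmoothPeriodic hE
  right_inv := toSmoothPeriodic_fourierRapid hE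

theorem continuous_toSmoothPeriodic (hE : IsSequentiallyComplete E) :
    Continuous fun x : Rapid d E => x.toSmoothPeriodic hE := by
  refine Continuous.subtype_mk ?_ _
  refine Smooth.withSeminorms.continuous_of_continuous_comp
    ((smoothPeriodicSubmodule d E).subtype ∘ₗ (seriesLinearEquiv hE).toLinearMap) fun q => ?_
  refine Seminorm.continuous_of_le (q := (weightSum d).toNNReal •
    Rapid.seminorm (q.2.1 + 2 * d) q.2.2) ?_ fun x => ?_
  · exact (Rapid.continuous_seminorm _ q.2.2.2).const_smul (weightSum d).toNNReal
  · refine (x.seminorm_toSmoothPeriodic_le hE q.1 q.2.1 q.2.2.2).trans_eq ?_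
    rw [_root_.smul_apply, NNReal.smul_def, Real.coe_toNNReal _ (weightSum_nonneg d), smul_eq_mul]

theorem continuous_fourierRapid (hE : IsSequentiallyComplete E) :
    Continuous (fourierRapid (d := d) hE) := by
  have : IsTopologicalAddGroup (Smooth d E) := Smooth.withSeminorms.topologicalAddGroup
  refine Rapid.withSeminorms.continuous_of_continuous_comp
    (seriesLinearEquiv hE).symm.toLinearMap fun q => ?_
  refine Seminorm.continuous_of_le (q := (((d : ℝ) + 1) ^ (q.1 + 1)).toNNReal •
    (Smooth.seminorm (cubeCompacts d) (2 * q.1) q.2).comp (smoothPeriodicSubmodule d E).subtype)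
    ?_ fun f => ?_
  · exact ((Smooth.withSeminorms.continuous_seminorm (cubeCompacts d, 2 * q.1, q.2)).comp
      continuous_subtype_val).const_smul (((d : ℝ) + 1) ^ (q.1 + 1)).toNNReal
  · rw [_root_.smul_apply, NNReal.smul_def, Real.coe_toNNReal _ (by positivity), smul_eq_mul]
    exact Rapid.seminorm_le _ q.2.2 _ fun n => seminorm_fourierCoeff_mul_weight_le hE f q.1 q.2.2 n

/-- The Fourier coefficient map as a topological isomorphism. -/
def fourierEquiv (hE : IsSequentiallyComplete E) : SmoothPeriodic d E ≃L[ℂ] Rapid d E :=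
  ContinuousLinearEquiv.symm
    { seriesLinearEquiv hE with
      continuous_toFun := continuous_toSmoothPeriodic hE
      continuous_invFun := continuous_fourierRapid hE }

end FourierMap

/-! ### The dual of the space of rapidly decreasing families -/

section RapidDual

variable {d : ℕ}

/-- Seminorms on `ℂ` are multiples of the modulus, so in the scalar case the weights alone describe
the topology of `s(ℤ^d)`. -/
theorem seminorm_complex_apply (p : Seminorm ℂ ℂ) (z : ℂ) : p z = ‖z‖ * p 1 := by
  rw [← map_smul_eq_mul, smul_eq_mul, mul_one]

theorem Rapid.exists_weight_of_mem_nhds {U : Set (Rapid d ℂ)} {y₀ : Rapid d ℂ} (hU : U ∈ 𝓝 y₀) :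
    ∃ (j : ℕ) (r : ℝ), 0 < r ∧
      ∀ y : Rapid d ℂ, (∀ k, ‖y k - y₀ k‖ * weight j k ≤ r) → y ∈ U := by
  obtain ⟨s, r, hr, h⟩ := (Rapid.withSeminorms.mem_nhds_iff y₀ U).1 hU
  have hM0 : 0 ≤ ∑ q ∈ s, q.2.1 1 := Finset.sum_nonneg fun _ _ => apply_nonneg _ _
  set M := ∑ q ∈ s, q.2.1 1 with hM
  have hr' : 0 < r / (M + 1) := by positivity
  -- The largest order controls all finitely many seminorms, and `M` bounds their scalar factors; `M
  -- + 1` keeps the quotient defined and the final bound `r M / (M + 1) < r` strict.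
  refine ⟨s.sup fun q => q.1, r / (M + 1), hr', fun y hy => h ?_⟩
  rw [Seminorm.mem_ball]
  refine Seminorm.finset_sup_apply_lt hr fun q hq => ?_
  have h3 : weight q.1 ≤ weight (d := d) (s.sup fun q => q.1) := fun k =>
    weight_mono (Finset.le_sup (f := fun q => q.1) hq) k
  have h4 : q.2.1 1 ≤ M := Finset.single_le_sum (f := fun q => q.2.1 1)
    (fun _ _ => apply_nonneg _ _) hq
  obtain ⟨i, p, hp⟩ := q
  have h1 : Rapid.seminorm i ⟨p, hp⟩ (y - y₀) ≤ r / (M + 1) * M := by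
    refine Rapid.seminorm_le i hp _ fun k => ?_
    have h2 : (y - y₀) k = y k - y₀ k := rfl
    rw [seminorm_complex_apply, h2, mul_right_comm]
    exact mul_le_mul ((mul_le_mul_of_nonneg_left (h3 k) (norm_nonneg _)).trans (hy k)) h4
      (apply_nonneg _ _) hr'.le
  refine h1.trans_lt ?_
  rw [div_mul_eq_mul_div, div_lt_iff₀ (by positivity)]
  exact mul_lt_mul_of_pos_left (lt_add_one _) hr

theorem continuous_normSeminorm_complex : Continuous (normSeminorm ℂ ℂ) := continuous_norm

/-- The unit families. -/
def Rapid.single (n : Fin d → ℤ) : Rapid d ℂ :=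
  Rapid.mk (Pi.single n 1) fun j p _ => ⟨p 1 * weight j n, fun k => by
    by_cases h : k = n
    · rw [h, Pi.single_eq_same]
    · rw [Pi.single_eq_of_ne h, map_zero, zero_mul]
      exact mul_nonneg (apply_nonneg _ _) (weight_nonneg _ _)⟩

theorem Rapid.single_apply (n k : Fin d → ℤ) : Rapid.single n k = if k = n then 1 else 0 := by
  rw [Rapid.single, Rapid.mk_apply, Pi.single_apply]

theorem Rapid.sum_smul_single_apply (A : Finset (Fin d → ℤ)) (y : Rapid d ℂ) (k : Fin d → ℤ) :
    (∑ n ∈ A, (y n : ℂ) • Rapid.single n) k = if k ∈ A then y k else 0 := by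
  have h : (∑ n ∈ A, (y n : ℂ) • Rapid.single n) k = ∑ n ∈ A, ((y n : ℂ) • Rapid.single n) k :=
    map_sum (Rapid.evalAt (E := ℂ) k) _ _
  rw [h]
  have h1 : ∀ n, ((y n : ℂ) • Rapid.single n) k = if k = n then y n else 0 := fun n => by
    rw [Rapid.coe_smul, Pi.smul_apply, Rapid.single_apply, smul_eq_mul, mul_ite, mul_one, mul_zero]
  simp only [h1, Finset.sum_ite_eq]

/-- Equicontinuous sets of functionals are uniformly dominated by a single weighted norm. -/
theorem exists_bound_of_equicontinuous {H : Set (DualKappa (Rapid d ℂ))}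
    (hH : H ∈ equicontinuousSets (Rapid d ℂ)) : ∃ (j : ℕ) (C : ℝ), 0 < C ∧
      ∀ f' ∈ H, ∀ (y : Rapid d ℂ) (B : ℝ), (∀ k, ‖y k‖ * weight j k ≤ B) → ‖f' y‖ ≤ C * B := by
  have h1 := Metric.equicontinuousAt_iff_right.1 (hH 0) 1 one_pos
  obtain ⟨j, r, hr, h⟩ := Rapid.exists_weight_of_mem_nhds h1
  refine ⟨j, r⁻¹, inv_pos.2 hr, fun f' hf' y B hB => ?_⟩
  have hB0 : 0 ≤ B := (mul_nonneg (norm_nonneg _) (weight_nonneg _ _)).trans (hB 0)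
  -- The bound `B` may be `0`, so `y` is rescaled by `r / (B + rε)` instead of `r / B`, and `ε` is
  -- then arbitrary.
  refine le_of_forall_pos_le_add fun ε hε => ?_
  have hB' : 0 < B + r * ε := by positivity
  have h2 := h (((r / (B + r * ε) : ℝ) : ℂ) • y) (fun k => by
    have h3 : (((r / (B + r * ε) : ℝ) : ℂ) • y) k - (0 : Rapid d ℂ) k =
        ((r / (B + r * ε) : ℝ) : ℂ) * y k := by
      rw [Rapid.coe_zero, Pi.zero_apply, sub_zero]
      rfl
    rw [h3, norm_mul, Complex.norm_real, Real.norm_of_nonneg (by positivity), mul_assoc,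
      div_mul_eq_mul_div, div_le_iff₀ hB']
    refine mul_le_mul_of_nonneg_left ((hB k).trans ?_) hr.le
    exact le_add_of_nonneg_right (by positivity)) ⟨f', hf'⟩
  rw [map_zero, dist_zero_left, map_smul, norm_smul, Complex.norm_real,
    Real.norm_of_nonneg (by positivity), div_mul_eq_mul_div, div_lt_iff₀ hB', one_mul] at h2
  rw [← mul_le_mul_iff_right₀ hr, mul_add, mul_inv_cancel_left₀ hr.ne']
  exact h2.le

theorem singleton_mem_equicontinuousSets (f' : DualKappa (Rapid d ℂ)) :
    {f'} ∈ equicontinuousSets (Rapid d ℂ) := by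
  intro y₀
  refine Metric.equicontinuousAt_iff_right.2 fun ε hε => ?_
  have h : Continuous f' := ContinuousLinearMap.continuous (f' : Rapid d ℂ →L[ℂ] ℂ)
  filter_upwards [Metric.tendsto_nhds.1 (h.tendsto y₀) ε hε] with y hy
  rintro ⟨_, rfl⟩
  rwa [dist_comm]

/-- The point evaluation `δ_n` as an element of the dual. -/
def Rapid.delta (n : Fin d → ℤ) : DualKappa (Rapid d ℂ) :=
  ContinuousLinearMap.toUniformConvergenceCLM _ _ _ (Rapid.evalAt n)

theorem Rapid.delta_apply (n : Fin d → ℤ) (y : Rapid d ℂ) : Rapid.delta n y = y n := rfl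

/-- The weighted point evaluations. -/
def weightedDeltas (d j : ℕ) : Set (DualKappa (Rapid d ℂ)) :=
  Set.range fun n => (weight j n : ℂ) • Rapid.delta n

theorem norm_weight_smul_delta (j : ℕ) (n : Fin d → ℤ) (y : Rapid d ℂ) :
    ‖((weight j n : ℂ) • Rapid.delta n) y‖ = ‖y n‖ * weight j n := by
  have h : ((weight j n : ℂ) • Rapid.delta n) y = (weight j n : ℂ) * y n := rfl
  rw [h, norm_mul, Complex.norm_real, Real.norm_of_nonneg (weight_nonneg _ _), mul_comm]

/-- The supremum of the moduli of these functionals is the continuous seminorm of order `j`. Hence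
convergence in the epsilon product controls that weight. -/
theorem weightedDeltas_mem_equicontinuousSets (d j : ℕ) :
    weightedDeltas d j ∈ equicontinuousSets (Rapid d ℂ) := by
  intro y₀
  refine Metric.equicontinuousAt_iff_right.2 fun ε hε => ?_
  have h1 := tendsto_nhds_iff_seminorm.1 (tendsto_id (x := 𝓝 y₀)) _
    (Rapid.continuous_seminorm (d := d) j continuous_normSeminorm_complex)
  filter_upwards [h1.eventually (gt_mem_nhds hε)] with y hy
  rintro ⟨_, n, rfl⟩
  refine lt_of_le_of_lt ?_ hy
  simp only
  rw [dist_comm, dist_eq_norm, ← map_sub, norm_weight_smul_delta]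
  exact (y - y₀).le_seminorm j continuous_normSeminorm_complex n

/-- The seminorm of order `j` is bounded on compact sets. A continuous `u` therefore maps these
functionals to a bounded set, which is the rapid decay of `u(δ_n)`. -/
theorem isVonNBounded_weightedDeltas (d j : ℕ) :
    Bornology.IsVonNBounded ℂ (weightedDeltas d j) := by
  refine UniformConvergenceCLM.isVonNBounded_iff.2 fun K hK => ?_
  obtain ⟨B, hB⟩ := hK.1.bddAbove_image
    (Rapid.continuous_seminorm (d := d) j continuous_normSeminorm_complex).continuousOn
  refine (NormedSpace.isVonNBounded_iff' ℂ).2 ⟨B, ?_⟩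
  rintro _ ⟨_, ⟨n, rfl⟩, y, hy, rfl⟩
  simp only
  rw [norm_weight_smul_delta]
  exact (y.le_seminorm j continuous_normSeminorm_complex n).trans (hB ⟨y, hy, rfl⟩)

/-- Every functional on `s(ℤ^d)` is the sum of its expansion into point evaluations, uniformly on
compact sets. -/
theorem hasSum_smul_delta (f' : DualKappa (Rapid d ℂ)) :
    HasSum (fun n => f' (Rapid.single n) • Rapid.delta n) f' := by
  obtain ⟨j, C, hC, hf⟩ := exists_bound_of_equicontinuous (singleton_mem_equicontinuousSets f')
  refine (UniformConvergenceCLM.tendsto_iff_tendstoUniformlyOn _ _ _).2 fun K hK => ?_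
  obtain ⟨B, hB⟩ := hK.1.bddAbove_image
    (Rapid.continuous_seminorm (d := d) (j + 2 * d) continuous_normSeminorm_complex).continuousOn
  rw [Metric.tendstoUniformlyOn_iff]
  intro ε hε
  have h1 : Tendsto (fun k : Fin d → ℤ => B * (weight (2 * d) k)⁻¹) cofinite (𝓝 0) := by
    simpa using (tendsto_weight_inv d).const_mul B
  have hε' : 0 < ε / (2 * C) := by positivity
  have h2 := h1.eventually (gt_mem_nhds hε')
  rw [eventually_cofinite] at h2
  filter_upwards [eventually_ge_atTop h2.toFinset] with A hA y hy
  -- A partial sum of the expansion acts as `f'` on the truncation of `y` to `A`. The remaining tail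
  -- is small in the norm of order `j`, uniformly on `K`, as `K` is bounded in order `j + 2d`.
  have h3 : (∑ n ∈ A, f' (Rapid.single n) • Rapid.delta n) y =
      f' (∑ n ∈ A, (y n : ℂ) • Rapid.single n) := by
    rw [map_sum, sum_apply]
    refine Finset.sum_congr rfl fun n _ => ?_
    rw [map_smul, smul_eq_mul, mul_comm]
    rfl
  rw [h3, dist_eq_norm, ← map_sub]
  refine (hf f' rfl _ (ε / (2 * C)) fun k => ?_).trans_lt ?_
  · have h4 : (y - ∑ n ∈ A, (y n : ℂ) • Rapid.single n) k = if k ∈ A then 0 else y k := by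
      have h5 : (y - ∑ n ∈ A, (y n : ℂ) • Rapid.single n) k =
          y k - (∑ n ∈ A, (y n : ℂ) • Rapid.single n) k := rfl
      rw [h5, Rapid.sum_smul_single_apply]
      split_ifs <;> simp
    rw [h4]
    split_ifs with hk
    · rw [norm_zero, zero_mul]
      exact hε'.le
    · have h6 : B * (weight (2 * d) k)⁻¹ < ε / (2 * C) := by
        by_contra hc
        exact hk (hA (h2.mem_toFinset.2 hc))
      exact (le_div_weight ((y.le_seminorm _ continuous_normSeminorm_complex k).trans
        (hB ⟨y, hy, rfl⟩))).trans h6.le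
  · have : C * (ε / (2 * C)) = ε / 2 := by field_simp
    rw [this]
    exact half_lt_self hε

/-- Boxes with rapidly decreasing side lengths are compact. -/
theorem isCompact_rapid_box {b : (Fin d → ℤ) → ℝ}
    (hb : ∀ j : ℕ, Tendsto (fun k => b k * weight j k) cofinite (𝓝 0))
    (hb' : ∀ j : ℕ, ∃ C, ∀ k, b k * weight j k ≤ C) :
    IsCompact {y : Rapid d ℂ | ∀ k, ‖y k‖ ≤ b k} := by
  -- The product of the discs is compact by Tychonoff, and the box is its image under `Φ`.
  -- Continuity of `Φ` holds because outside finitely many coordinates the weighted size is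
  -- uniformly small.
  let P : Set ((Fin d → ℤ) → ℂ) := Set.univ.pi fun k => Metric.closedBall 0 (b k)
  have hP : IsCompact P := isCompact_univ_pi fun k => isCompact_closedBall _ _
  have : CompactSpace P := isCompact_iff_compactSpace.1 hP
  have hmem : ∀ (y : P) k, ‖y.1 k‖ ≤ b k := fun y k =>
    mem_closedBall_zero_iff.1 (y.2 k (Set.mem_univ k))
  let Φ : P → Rapid d ℂ := fun y => Rapid.mk y.1 fun j p _ => by
    obtain ⟨C, hC⟩ := hb' j
    refine ⟨p 1 * C, fun k => ?_⟩
    rw [seminorm_complex_apply, mul_comm ‖_‖, mul_assoc]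
    exact mul_le_mul_of_nonneg_left ((mul_le_mul_of_nonneg_right (hmem y k)
      (weight_nonneg _ _)).trans (hC k)) (apply_nonneg _ _)
  have hΦ : ∀ y k, Φ y k = y.1 k := fun _ _ => rfl
  have hcont : Continuous Φ := by
    refine continuous_iff_continuousAt.2 fun y₀ U hU => ?_
    obtain ⟨j, r, hr, h⟩ := Rapid.exists_weight_of_mem_nhds hU
    -- Half of `r`, since coordinates of two points of the box can differ by `2 b k`.
    have h2 := (hb j).eventually (gt_mem_nhds (half_pos hr))
    rw [eventually_cofinite] at h2
    have h3 : ∀ᶠ y in 𝓝 y₀, ∀ k ∈ h2.toFinset, ‖y.1 k - y₀.1 k‖ * weight j k < r := by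
      rw [eventually_all_finset]
      intro k _
      have h4 : Tendsto (fun y : P => ‖y.1 k - y₀.1 k‖ * weight j k) (𝓝 y₀)
          (𝓝 (‖y₀.1 k - y₀.1 k‖ * weight j k)) :=
        (((((continuous_apply k).comp continuous_subtype_val).tendsto y₀).sub_const _).norm).mul_const
          _
      rw [sub_self, norm_zero, zero_mul] at h4
      exact h4.eventually (gt_mem_nhds hr)
    refine mem_map.2 ?_
    filter_upwards [h3] with y hy
    refine h _ fun k => ?_
    rw [hΦ, hΦ]
    by_cases hk : k ∈ h2.toFinset
    · exact (hy k hk).le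
    · have h6 : b k * weight j k < r / 2 := by
        by_contra hc
        exact hk (h2.mem_toFinset.2 hc)
      have h7 := mul_le_mul_of_nonneg_right ((norm_sub_le (y.1 k) (y₀.1 k)).trans
        (add_le_add (hmem y k) (hmem y₀ k))) (weight_nonneg j k)
      linarith
  have hK : {y : Rapid d ℂ | ∀ k, ‖y k‖ ≤ b k} = Set.range Φ := by
    ext y
    constructor
    · intro hy
      exact ⟨⟨y, fun k _ => mem_closedBall_zero_iff.2 (hy k)⟩, Rapid.ext fun k => rfl⟩
    · rintro ⟨z, rfl⟩ k
      exact hmem z k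
  rw [hK]
  exact isCompact_range hcont

theorem balanced_rapid_box (b : (Fin d → ℤ) → ℝ) :
    Balanced ℂ {y : Rapid d ℂ | ∀ k, ‖y k‖ ≤ b k} := by
  rintro a ha _ ⟨y, hy, rfl⟩ k
  change ‖a • y k‖ ≤ b k
  rw [norm_smul]
  exact (mul_le_of_le_one_left (norm_nonneg _) ha).trans (hy k)

theorem convex_rapid_box (b : (Fin d → ℤ) → ℝ) :
    Convex ℝ {y : Rapid d ℂ | ∀ k, ‖y k‖ ≤ b k} := by
  intro y hy z hz s t hs ht hst k
  have h : (s • y + t • z) k = (s : ℂ) * y k + (t : ℂ) * z k := rfl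
  rw [h]
  refine (norm_add_le _ _).trans ?_
  rw [norm_mul, norm_mul, Complex.norm_real, Complex.norm_real, Real.norm_of_nonneg hs,
    Real.norm_of_nonneg ht]
  calc s * ‖y k‖ + t * ‖z k‖ ≤ s * b k + t * b k :=
        add_le_add (mul_le_mul_of_nonneg_left (hy k) hs) (mul_le_mul_of_nonneg_left (hz k) ht)
    _ = b k := by rw [← add_mul, hst, one_mul]

end RapidDual

/-! ### The epsilon product with the space of rapidly decreasing families -/

section RapidEpsilon

variable {d : ℕ} {E : Type*} [AddCommGroup E] [Module ℂ E] [UniformSpace E]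
  [IsUniformAddGroup E] [ContinuousSMul ℂ E] [T2Space E] [PolynormableSpace ℂ E]

/-- The family `n ↦ u (δ_n)`. -/
def rapidEval (u : EpsProd (Rapid d ℂ) E) : Rapid d E :=
  Rapid.mk (fun n => u (Rapid.delta n)) fun j p hp => by
    have h1 : Bornology.IsVonNBounded ℂ (u '' weightedDeltas d j) :=
      (isVonNBounded_weightedDeltas d j).image (u : DualKappa (Rapid d ℂ) →L[ℂ] E)
    obtain ⟨r, _, hr⟩ :=
      ((PolynormableSpace.withSeminorms ℂ E).isVonNBounded_iff_seminorm_bounded.1 h1) ⟨p, hp⟩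
    refine ⟨r, fun k => ?_⟩
    have h2 := (hr _ ⟨_, ⟨k, rfl⟩, rfl⟩).le
    rwa [map_smul, map_smul_eq_mul, Complex.norm_real, Real.norm_of_nonneg (weight_nonneg _ _),
      mul_comm] at h2

theorem rapidEval_apply (u : EpsProd (Rapid d ℂ) E) (n : Fin d → ℤ) :
    rapidEval u n = u (Rapid.delta n) := rfl

/-- Continuity of `u` carries the expansion of `f'` over to `E`; thus `u` is determined by its
values at the `δ_n`, and the inverse map can be read off. -/
theorem hasSum_eval_delta (u : EpsProd (Rapid d ℂ) E) (f' : DualKappa (Rapid d ℂ)) :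
    HasSum (fun n => f' (Rapid.single n) • u (Rapid.delta n)) (u f') := by
  have h := (hasSum_smul_delta f').mapL (u : DualKappa (Rapid d ℂ) →L[ℂ] E)
  refine h.congr_fun fun n => ?_
  exact (map_smul (u : DualKappa (Rapid d ℂ) →L[ℂ] E) _ _).symm

theorem norm_apply_single_le {H : Set (DualKappa (Rapid d ℂ))} {j : ℕ} {C : ℝ}
    (h : ∀ f' ∈ H, ∀ (y : Rapid d ℂ) (B : ℝ), (∀ k, ‖y k‖ * weight j k ≤ B) → ‖f' y‖ ≤ C * B)
    {f' : DualKappa (Rapid d ℂ)} (hf' : f' ∈ H) (n : Fin d → ℤ) :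
    ‖f' (Rapid.single n)‖ ≤ C * weight j n := by
  refine h f' hf' _ _ fun k => ?_
  rw [Rapid.single_apply]
  split_ifs with hk
  · rw [hk, norm_one, one_mul]
  · rw [norm_zero, zero_mul]
    exact weight_nonneg _ _

theorem summable_single_mul_seminorm (f' : DualKappa (Rapid d ℂ)) (x : Rapid d E)
    {p : Seminorm ℂ E} (hp : Continuous p) :
    Summable fun n => p (f' (Rapid.single n) • x n) := by
  obtain ⟨j, C, _, h⟩ := exists_bound_of_equicontinuous (singleton_mem_equicontinuousSets f')
  refine ((x.summable_mul_weight hp j).mul_left C).of_nonneg_of_le (fun _ => apply_nonneg _ _)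
    fun n => ?_
  rw [map_smul_eq_mul, mul_comm (p (x n)), ← mul_assoc]
  exact mul_le_mul_of_nonneg_right (norm_apply_single_le h rfl n) (apply_nonneg _ _)

/-- The value at `f'` of the element of the epsilon product given by the family `x`. -/
def epsValue (x : Rapid d E) (f' : DualKappa (Rapid d ℂ)) : E := ∑' n, f' (Rapid.single n) • x n

theorem hasSum_epsValue (hE : IsSequentiallyComplete E) (x : Rapid d E)
    (f' : DualKappa (Rapid d ℂ)) :
    HasSum (fun n => f' (Rapid.single n) • x n) (epsValue x f') :=
  (summable_of_seminorm hE fun _ hp => summable_single_mul_seminorm f' x hp).hasSum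

theorem seminorm_epsValue_le (hE : IsSequentiallyComplete E) (x : Rapid d E)
    (f' : DualKappa (Rapid d ℂ)) {p : Seminorm ℂ E} (hp : Continuous p) :
    p (epsValue x f') ≤ ∑' n, p (f' (Rapid.single n) • x n) :=
  seminorm_le_tsum hp (hasSum_epsValue hE x f') (summable_single_mul_seminorm f' x hp)

/-- `epsValue x` as a linear map. -/
def epsLinear (hE : IsSequentiallyComplete E) (x : Rapid d E) : DualKappa (Rapid d ℂ) →ₗ[ℂ] E where
  toFun := epsValue x
  map_add' f g := by
    have h := (hasSum_epsValue hE x f).add (hasSum_epsValue hE x g)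
    simp only [← add_smul] at h
    exact (hasSum_epsValue hE x (f + g)).unique h
  map_smul' c f := by
    have h := (hasSum_epsValue hE x f).const_smul c
    simp only [smul_smul] at h
    exact (hasSum_epsValue hE x (c • f)).unique h

/-- If `f'` is small on the box with sides `b n`, then evaluating it at `b n • e_n` bounds
`|f'(e_n)| p(x_n)` by a small multiple of the summable inverse weight. The box is absolutely convex
and compact, hence admissible for the `κ`-topology. -/
theorem continuous_epsLinear (hE : IsSequentiallyComplete E) (x : Rapid d E) :
    Continuous (epsLinear hE x) := by
  refine continuous_of_continuousAt_zero (epsLinear hE x) ?_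
  refine tendsto_nhds_iff_seminorm.2 fun p hp => Metric.tendsto_nhds.2 fun ε hε => ?_
  let b : (Fin d → ℤ) → ℝ := fun n => p (x n) * weight (2 * d) n
  have hbj : ∀ j k, b k * weight j k = p (x k) * weight (2 * d + j) k := fun j k => by
    rw [weight_add, mul_assoc]
  have hK : {y : Rapid d ℂ | ∀ k, ‖y k‖ ≤ b k} ∈
      {K : Set (Rapid d ℂ) | IsCompact K ∧ Balanced ℂ K ∧ Convex ℝ K} :=
    ⟨isCompact_rapid_box
      (fun j => by
        simp only [hbj]
        exact (x.summable_mul_weight hp _).tendsto_cofinite_zero)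
      (fun j => ⟨_, fun k => (hbj j k).trans_le (x.le_seminorm _ hp k)⟩),
      balanced_rapid_box b, convex_rapid_box b⟩
  have hW : 0 < weightSum d + 1 := by linarith [weightSum_nonneg d]
  have hε' : 0 < ε / (weightSum d + 1) := by positivity
  filter_upwards [UniformConvergenceCLM.eventually_nhds_zero_mapsTo (RingHom.id ℂ) hK
    (Metric.ball_mem_nhds (0 : ℂ) hε')] with f' hf'
  have h1 : ∀ n, p (f' (Rapid.single n) • x n) ≤
      ε / (weightSum d + 1) * (weight (2 * d) n)⁻¹ := fun n => by
    have h2 : ((b n : ℂ) • Rapid.single n) ∈ {y : Rapid d ℂ | ∀ k, ‖y k‖ ≤ b k} := fun k => by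
      have hb : ∀ k, 0 ≤ b k := fun k => mul_nonneg (apply_nonneg _ _) (weight_nonneg _ _)
      rw [Rapid.coe_smul, Pi.smul_apply, Rapid.single_apply, norm_smul, Complex.norm_real,
        Real.norm_of_nonneg (hb n)]
      split_ifs with hk
      · rw [hk, norm_one, mul_one]
      · rw [norm_zero, mul_zero]
        exact hb k
    have h3 := (mem_ball_zero_iff.1 (hf' h2)).le
    rw [map_smul, norm_smul, Complex.norm_real, Real.norm_of_nonneg
      (mul_nonneg (apply_nonneg _ _) (weight_nonneg _ _)), mul_comm, ← mul_assoc] at h3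
    rwa [map_smul_eq_mul, ← div_eq_mul_inv, le_div_iff₀ (weight_pos _ _)]
  have h4 : p (epsLinear hE x f') ≤ ε / (weightSum d + 1) * weightSum d := by
    refine (seminorm_epsValue_le hE x f' hp).trans ?_
    rw [weightSum, ← tsum_mul_left]
    exact (summable_single_mul_seminorm f' x hp).tsum_le_tsum h1
      ((summable_weight_inv d).mul_left _)
  rw [map_zero, sub_zero, Real.dist_eq, sub_zero, abs_of_nonneg (apply_nonneg _ _)]
  refine h4.trans_lt ?_
  rw [div_mul_eq_mul_div, div_lt_iff₀ hW]
  exact mul_lt_mul_of_pos_left (lt_add_one _) hε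

/-- The element `f' ↦ ∑ f' (e_n) x_n` of the epsilon product. -/
def epsOfRapid (hE : IsSequentiallyComplete E) (x : Rapid d E) : EpsProd (Rapid d ℂ) E :=
  ContinuousLinearMap.toUniformConvergenceCLM _ _ _ ⟨epsLinear hE x, continuous_epsLinear hE x⟩

theorem epsOfRapid_apply (hE : IsSequentiallyComplete E) (x : Rapid d E)
    (f' : DualKappa (Rapid d ℂ)) : epsOfRapid hE x f' = epsValue x f' := rfl

theorem epsOfRapid_rapidEval (hE : IsSequentiallyComplete E) (u : EpsProd (Rapid d ℂ) E) :
    epsOfRapid hE (rapidEval u) = u :=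
  DFunLike.ext _ _ fun f' => (hasSum_eval_delta u f').tsum_eq

theorem rapidEval_epsOfRapid (hE : IsSequentiallyComplete E) (x : Rapid d E) :
    rapidEval (epsOfRapid hE x) = x := by
  refine Rapid.ext fun n => ?_
  rw [rapidEval_apply, epsOfRapid_apply, epsValue, tsum_eq_single n]
  · rw [Rapid.delta_apply, Rapid.single_apply, if_pos rfl, one_smul]
  · intro k hk
    rw [Rapid.delta_apply, Rapid.single_apply, if_neg (Ne.symm hk), zero_smul]

/-- `u ↦ (u (δ_n))_n` as a linear bijection. -/
def rapidEvalLinearEquiv (hE : IsSequentiallyComplete E) :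
    EpsProd (Rapid d ℂ) E ≃ₗ[ℂ] Rapid d E where
  toFun := rapidEval
  map_add' _ _ := rfl
  map_smul' _ _ := rfl
  invFun := epsOfRapid hE
  left_inv := epsOfRapid_rapidEval hE
  right_inv := rapidEval_epsOfRapid hE

theorem continuous_rapidEval (hE : IsSequentiallyComplete E) :
    Continuous (rapidEval : EpsProd (Rapid d ℂ) E → Rapid d E) := by
  refine continuous_of_continuousAt_zero (rapidEvalLinearEquiv (d := d) hE) ?_
  refine (Rapid.withSeminorms.tendsto_nhds _ _).2 ?_
  rintro ⟨j, p, hp⟩ ε hε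
  -- Half of `ε`, because passing to the supremum over `k` loses strictness.
  have hU : {v : E | p v < ε / 2} ∈ 𝓝 (0 : E) := by
    have h := hp.tendsto 0
    rw [map_zero] at h
    exact h.eventually (gt_mem_nhds (half_pos hε))
  filter_upwards [UniformConvergenceCLM.eventually_nhds_zero_mapsTo (RingHom.id ℂ)
    (weightedDeltas_mem_equicontinuousSets d j) hU] with u hu
  rw [map_zero, sub_zero]
  refine (Rapid.seminorm_le j hp _ fun k => ?_).trans_lt (half_lt_self hε)
  have h2 : p (u ((weight j k : ℂ) • Rapid.delta k)) < ε / 2 := hu ⟨k, rfl⟩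
  rw [map_smul, map_smul_eq_mul, Complex.norm_real, Real.norm_of_nonneg (weight_nonneg _ _),
    mul_comm] at h2
  exact h2.le

/-- On an equicontinuous set `|f'(e_n)|` is at most `C` times the weight of order `j`, uniformly in
`f'`, so `p` of the value is bounded by a multiple of the seminorm of order `j + 2d` of `x`. -/
theorem continuous_epsOfRapid (hE : IsSequentiallyComplete E) :
    Continuous (epsOfRapid (d := d) hE) := by
  refine continuous_of_continuousAt_zero (rapidEvalLinearEquiv (d := d) hE).symm ?_
  rw [ContinuousAt, map_zero, UniformConvergenceCLM.nhds_zero_eq]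
  simp only [tendsto_iInf, tendsto_principal]
  intro H hH U hU
  obtain ⟨p, hp, hpU⟩ := exists_seminorm_of_mem_nhds hU
  obtain ⟨j, C, hC, h⟩ := exists_bound_of_equicontinuous hH
  have h1 : Tendsto (fun x : Rapid d E =>
      C * (Rapid.seminorm (j + 2 * d) ⟨p, hp⟩ x * weightSum d)) (𝓝 0) (𝓝 0) := by
    have h2 := (((Rapid.continuous_seminorm (d := d) (j + 2 * d) hp).tendsto 0).mul_const
      (weightSum d)).const_mul C
    rwa [map_zero, zero_mul, mul_zero] at h2
  filter_upwards [h1.eventually (gt_mem_nhds one_pos)] with x hx f' hf'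
  refine hpU _ ?_
  rw [sub_zero]
  refine lt_of_le_of_lt ?_ hx
  refine (seminorm_epsValue_le hE x f' hp).trans ?_
  refine le_trans ?_ (mul_le_mul_of_nonneg_left (tsum_mul_weight_le (fun _ => apply_nonneg p _)
    (x.le_seminorm (j + 2 * d) hp)) hC.le)
  rw [← tsum_mul_left]
  refine (summable_single_mul_seminorm f' x hp).tsum_le_tsum (fun n => ?_)
    ((x.summable_mul_weight hp j).mul_left C)
  rw [map_smul_eq_mul, mul_comm (p (x n)), ← mul_assoc]
  exact mul_le_mul_of_nonneg_right (norm_apply_single_le h hf' n) (apply_nonneg _ _)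

/-- `u ↦ (u (δ_n))_n` as a topological isomorphism. -/
def rapidEvalEquiv (hE : IsSequentiallyComplete E) :
    EpsProd (Rapid d ℂ) E ≃L[ℂ] Rapid d E :=
  { rapidEvalLinearEquiv hE with
    continuous_toFun := continuous_rapidEval hE
    continuous_invFun := continuous_epsOfRapid hE }

end RapidEpsilon

/-! ### The epsilon product of isomorphisms and the evaluation map on smooth functions -/

section SmoothEpsilon

variable {E : Type*} [AddCommGroup E] [Module ℂ E] [TopologicalSpace E]
  [IsTopologicalAddGroup E] [ContinuousConstSMul ℂ E]

/-- A topological isomorphism induces one between the epsilon products. -/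
def epsEquiv {F₁ F₂ : Type*} [AddCommGroup F₁] [Module ℂ F₁] [TopologicalSpace F₁]
    [AddCommGroup F₂] [Module ℂ F₂] [TopologicalSpace F₂] (T : F₁ ≃L[ℂ] F₂) :
    EpsProd F₁ E ≃L[ℂ] EpsProd F₂ E :=
  ContinuousLinearEquiv.equivOfInverse
    (epsMap (T : F₁ →L[ℂ] F₂) (ContinuousLinearMap.id ℂ E))
    (epsMap (T.symm : F₂ →L[ℂ] F₁) (ContinuousLinearMap.id ℂ E))
    (fun u => DFunLike.ext _ _ fun f' => congrArg u (DFunLike.ext _ _ fun y =>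
      congrArg f' (T.symm_apply_apply y)))
    (fun u => DFunLike.ext _ _ fun f' => congrArg u (DFunLike.ext _ _ fun y =>
      congrArg f' (T.apply_symm_apply y)))

end SmoothEpsilon

/-! ### The evaluation map on periodic functions, through Fourier coefficients -/

section SmoothEval

variable {d : ℕ} {E : Type*} [AddCommGroup E] [Module ℂ E] [UniformSpace E]
  [IsUniformAddGroup E] [ContinuousSMul ℂ E] [T2Space E] [PolynormableSpace ℂ E]

theorem isSequentiallyComplete_complex : IsSequentiallyComplete ℂ :=
  fun _ hu => cauchySeq_tendsto_of_complete hu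

/-- `u ↦ (x ↦ u (δ_x))` as a topological isomorphism. -/
def smoothEvalEquiv (hE : IsSequentiallyComplete E) :
    EpsProd (SmoothPeriodic d ℂ) E ≃L[ℂ] SmoothPeriodic d E :=
  ((epsEquiv (fourierEquiv isSequentiallyComplete_complex)).trans (rapidEvalEquiv hE)).trans
    (fourierEquiv hE).symm

theorem series_single (n : Fin d → ℤ) (t : Fin d → ℝ) :
    (Rapid.single n).series t = character n t := by
  rw [Rapid.series, tsum_eq_single n]
  · rw [Rapid.single_apply, if_pos rfl, smul_eq_mul, mul_one]
  · intro k hk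
    rw [Rapid.single_apply, if_neg hk, smul_zero]

/-- Transported to `s(ℤ^d)`, the functional `δ_t` takes the value `character n t` at `e_n`. Its
expansion into the `δ_n` is therefore exactly the trigonometric series by which the composite is
evaluated at `t`. -/
theorem isSmoothEvalMap_smoothEvalEquiv (hE : IsSequentiallyComplete E) :
    IsSmoothEvalMap (smoothEvalEquiv (d := d) hE) := by
  intro u t
  let T := fourierEquiv (d := d) isSequentiallyComplete_complex
  let δ : DualKappa (SmoothPeriodic d ℂ) :=
    ContinuousLinearMap.toUniformConvergenceCLM _ _ _ (SmoothPeriodic.evalAt t)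
  let f' : DualKappa (Rapid d ℂ) := dualMap (T.symm : Rapid d ℂ →L[ℂ] SmoothPeriodic d ℂ) δ
  have h1 := hasSum_eval_delta (epsEquiv T u) f'
  have h2 : ∀ n, f' (Rapid.single n) = character n t := fun n => series_single n t
  have h3 : epsEquiv T u f' = u δ :=
    congrArg u (DFunLike.ext _ _ fun g => congrArg δ (T.symm_apply_apply g))
  simp only [h2, h3] at h1
  exact h1.tsum_eq

end SmoothEval

end PeriodicFourier

end

open PeriodicFourier
theorem theorem4p11 {E : Type*} [AddCommGroup E] [Module ℂ E] [UniformSpace E]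
    [IsUniformAddGroup E] [ContinuousSMul ℂ E] [T2Space E] [PolynormableSpace ℂ E]
    (hE : IsSequentiallyComplete E) (d : ℕ) :
    (∀ (f : SmoothPeriodic d E) (n : Fin d → ℤ),
      PettisIntegrable volume (cube d) (fourierIntegrand f n)) ∧
    ∃ (FE : SmoothPeriodic d E ≃L[ℂ] Rapid d E)
      (FC : SmoothPeriodic d ℂ ≃L[ℂ] Rapid d ℂ)
      (Ssmooth : EpsProd (SmoothPeriodic d ℂ) E ≃L[ℂ] SmoothPeriodic d E)
      (Srapid : EpsProd (Rapid d ℂ) E ≃L[ℂ] Rapid d E),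
      IsFourierMap FE ∧ IsFourierMap FC ∧ IsSmoothEvalMap Ssmooth ∧ IsRapidEvalMap Srapid ∧
      (FE : SmoothPeriodic d E →L[ℂ] Rapid d E) =
        (Srapid : EpsProd (Rapid d ℂ) E →L[ℂ] Rapid d E) ∘L
          epsMap (FC : SmoothPeriodic d ℂ →L[ℂ] Rapid d ℂ) (ContinuousLinearMap.id ℂ E) ∘L
          (Ssmooth.symm : SmoothPeriodic d E →L[ℂ] EpsProd (SmoothPeriodic d ℂ) E) := by
  refine ⟨fun f n => exists_hasPettisIntegral hE (continuous_fourierIntegrand f n),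
    fourierEquiv hE, fourierEquiv isSequentiallyComplete_complex, smoothEvalEquiv hE,
    rapidEvalEquiv hE, fun _ _ => rfl, fun _ _ => rfl, isSmoothEvalMap_smoothEvalEquiv hE,
    fun _ _ => rfl, ?_⟩
  refine ContinuousLinearMap.ext fun f => ?_
  -- As `smoothEvalEquiv` is by construction the composite ending in `(𝔉^E)⁻¹`, moving that factor
  -- to the other side is the asserted identity.
  have h := (smoothEvalEquiv hE).apply_symm_apply f
  exact (((fourierEquiv hE).symm_apply_eq).1 h).symm
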